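/- Let $D$ be a link diagram with at least one crossing: the image in the plane $\mathbb{R}^2$ of a link smoothly embedded in $\mathbb{R}^3$ (finitely many disjoint smooth closed curves) under the natural projection, where the projection restricted to the link is an immersion whose only singular points are transverse double points (the crossings), together with the over/under information. The diagram need not be connected. The regions of $D$ are the connected components of the complement of the projection image, taken either in $\mathbb{R}^2$ or in the sphere $S^2=\mathbb{R}^2\cup\{\infty\}$. Let $x_1,\dots,x_n$ be the crossings and $R_1,\dots,R_m$ the regions of $D$. Each crossing has four corners; a corner is called positive if turning counterclockwise through it leads from the underpass to the overpass, and negative otherwise. Define four $n\times m$ integer matrices as follows. - $A_{d1}(D)$ (definite, single counting): the $(i,j)$ entry is $1$ if $x_i\in\partial R_j$, and $0$ otherwise. - $A_{d2}(D)$ (definite, double counting): the $(i,j)$ entry is $2$ if $R_j$ touches $x_i$ at two corners, and equals that of $A_{d1}(D)$ otherwise. - $A_{a1}(D)$ (alternating, single counting): the $(i,j)$ entry is $1$ if $R_j$ touches $x_i$ at a positive corner, $-1$ if $R_j$ touches $x_i$ at a negative corner, and $0$ if $x_i\notin\partial R_j$. - $A_{a2}(D)$ (alternating, double counting): the $(i,j)$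 entry is twice that of $A_{a1}(D)$ if $R_j$ touches $x_i$ at two opposite corners, and equals that of $A_{a1}(D)$ otherwise. Let $\Phi_{d1}(D),\Phi_{d2}(D),\Phi_{a1}(D),\Phi_{a2}(D):\mathbb{Z}^m\to\mathbb{Z}^n$ be the homomorphisms represented by these matrices. Then: 1. The image of $\Phi_{d1}(D)$ coincides with the image of $\Phi_{d2}(D)$. 2. The image of $\Phi_{a1}(D)$ coincides with the image of $\Phi_{a2}(D)$. Consequently, for every score vector $\mathbf{c}\in\mathbb{Z}^n$, the equation $A_{d1}(D)\mathbf{u}+\mathbf{c}=\mathbf{0}$ has a solution $\mathbf{u}\in\mathbb{Z}^m$ if and only if $A_{d2}(D)\mathbf{w}+\mathbf{c}=\mathbf{0}$ has a solution $\mathbf{w}\in\mathbb{Z}^m$, and $A_{a1}(D)\mathbf{u}+\mathbf{c}=\mathbf{0}$ has a solution if and only if $A_{a2}(D)\mathbf{w}+\mathbf{c}=\mathbf{0}$ has one. -/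

import Mathlib

open scoped ContDiff Topology

noncomputable section

/-- The determinant `det (z, w)` of two vectors of the plane `ℝ² = ℂ`; it is positive exactly when
the shortest rotation from the direction of `z` to the direction of `w` is counterclockwise. -/
def planeDet (z w : ℂ) : ℝ := z.re * w.im - z.im * w.re

/-- A diagram of a link in `ℝ³ = ℂ × ℝ`, where `ℂ` is the projection plane `ℝ²`.

The link has finitely many components. The `i`-th one is the smooth closed curve
`t ↦ (curve i t, height i t)` of period `1`. Parameters of the points of the link are the pairs
`(i, t)` with `t ∈ [0, 1)`. -/
structure LinkDiagram where
  /-- the number of link components -/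
  numComponents : ℕ
  /-- the projection of each component to the plane -/
  curve : Fin numComponents → ℝ → ℂ
  /-- the height of each component above the plane, which gives the over/under information -/
  height : Fin numComponents → ℝ → ℝ
  contDiff_curve : ∀ i, ContDiff ℝ ∞ (curve i)
  contDiff_height : ∀ i, ContDiff ℝ ∞ (height i)
  periodic_curve : ∀ i, Function.Periodic (curve i) 1
  periodic_height : ∀ i, Function.Periodic (height i) 1
  /-- the projection is an immersion -/
  deriv_curve_ne_zero : ∀ i t, deriv (curve i) t ≠ 0
  /-- the link is embedded in `ℝ³` -/
  embedded : ∀ p q : Fin numComponents × Set.Ico (0 : ℝ) 1,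
    curve p.1 p.2 = curve q.1 q.2 → height p.1 p.2 = height q.1 q.2 → p = q
  /-- no point of the plane is the image of three points of the link -/
  at_most_double : ∀ p q r : Fin numComponents × Set.Ico (0 : ℝ) 1,
    curve p.1 p.2 = curve q.1 q.2 → curve q.1 q.2 = curve r.1 r.2 → p = q ∨ q = r ∨ p = r
  /-- the strands meet transversely at every double point -/
  transverse : ∀ p q : Fin numComponents × Set.Ico (0 : ℝ) 1,
    p ≠ q → curve p.1 p.2 = curve q.1 q.2 →
      planeDet (deriv (curve p.1) p.2) (deriv (curve q.1) q.2) ≠ 0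

namespace LinkDiagram

/-- The parameters of the points of the link. -/
abbrev Param (D : LinkDiagram) : Type := Fin D.numComponents × Set.Ico (0 : ℝ) 1

/-- The position in the plane of a point of the link. -/
def pos (D : LinkDiagram) (p : D.Param) : ℂ := D.curve p.1 p.2

/-- The velocity in the plane at a point of the link. -/
def vel (D : LinkDiagram) (p : D.Param) : ℂ := deriv (D.curve p.1) p.2

/-- The projection image of the link. -/
def image (D : LinkDiagram) : Set ℂ := Set.range D.pos

/-- A crossing, given by its overpass and its underpass. -/
structure Crossing (D : LinkDiagram) where
  /-- the point of the link on the overpass -/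
  overPt : D.Param
  /-- the point of the link on the underpass -/
  underPt : D.Param
  pos_eq : D.pos overPt = D.pos underPt
  height_lt : D.height underPt.1 underPt.2 < D.height overPt.1 overPt.2

/-- The double point of the projection at a crossing. -/
def Crossing.point {D : LinkDiagram} (x : D.Crossing) : ℂ := D.pos x.overPt

/-- The regions of the diagram: the connected components of the complement of the projection image
in a surface `S`, into which the plane is included by `e`. We take `S = ℝ²`, `e = id` for a diagram
on the plane, and `S = S² = ℝ² ∪ {∞}` with its standard inclusion for a diagram on the sphere. -/
def Region (D : LinkDiagram) {S : Type} [TopologicalSpace S] (e : ℂ → S) : Type :=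
  {R : Set S // ∃ p ∈ (e '' D.image)ᶜ, R = connectedComponentIn (e '' D.image)ᶜ p}

/-- The four corners around a crossing. The corner `(a, b)` lies between the ray of direction
`a • (velocity of the overpass)` and the ray of direction `b • (velocity of the underpass)`. Thus
`(a, b)` and `-(a, b)` are opposite corners, and other distinct corners are adjacent. -/
abbrev Corner : Type := ℤˣ × ℤˣ

/-- A vector at the crossing that points into the given corner. -/
def Crossing.direction {D : LinkDiagram} (x : D.Crossing) (k : Corner) : ℂ :=
  ((k.1 : ℤ) : ℝ) • D.vel x.overPt + ((k.2 : ℤ) : ℝ) • D.vel x.underPt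

/-- The region `R` touches the crossing `x` at the corner `k`: it contains all points close to `x`
on the ray from `x` into that corner. -/
def Touches (D : LinkDiagram) {S : Type} [TopologicalSpace S] (e : ℂ → S)
    (R : D.Region e) (x : D.Crossing) (k : Corner) : Prop :=
  ∀ᶠ t : ℝ in 𝓝[>] 0, e (x.point + t • x.direction k) ∈ R.1

/-- The corner is contained by the underpass and the overpass counterclockwise: turning
counterclockwise through the corner leads from its ray on the underpass to its ray on the overpass.
At the other two corners the turn from the underpass to the overpass is clockwise. -/
def Crossing.IsPositiveCorner {D : LinkDiagram} (x : D.Crossing) (k : Corner) : Prop :=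
  0 < planeDet (((k.2 : ℤ) : ℝ) • D.vel x.underPt) (((k.1 : ℤ) : ℝ) • D.vel x.overPt)

open Classical in
/-- The definite region choice matrix of the single counting rule. -/
def matrixD1 (D : LinkDiagram) {S : Type} [TopologicalSpace S] (e : ℂ → S) :
    Matrix D.Crossing (D.Region e) ℤ :=
  fun x R => if e x.point ∈ frontier R.1 then 1 else 0

open Classical in
/-- The definite region choice matrix of the double counting rule. -/
def matrixD2 (D : LinkDiagram) {S : Type} [TopologicalSpace S] (e : ℂ → S) :
    Matrix D.Crossing (D.Region e) ℤ :=
  fun x R =>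
    if ∃ k k' : Corner, k ≠ k' ∧ D.Touches e R x k ∧ D.Touches e R x k' then 2
    else D.matrixD1 e x R

open Classical in
/-- The alternating region choice matrix of the single counting rule. -/
def matrixA1 (D : LinkDiagram) {S : Type} [TopologicalSpace S] (e : ℂ → S) :
    Matrix D.Crossing (D.Region e) ℤ :=
  fun x R =>
    if ∃ k, D.Touches e R x k ∧ x.IsPositiveCorner k then 1
    else if ∃ k, D.Touches e R x k ∧ ¬ x.IsPositiveCorner k then -1
    else 0

open Classical in
/-- The alternating region choice matrix of the double counting rule. -/
def matrixA2 (D : LinkDiagram) {S : Type} [TopologicalSpace S] (e : ℂ → S) :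
    Matrix D.Crossing (D.Region e) ℤ :=
  fun x R =>
    if ∃ k : Corner, D.Touches e R x k ∧ D.Touches e R x (-k) then 2 * D.matrixA1 e x R
    else D.matrixA1 e x R

/-- The `ℤ`-homomorphism represented by a matrix `A` with a row for each crossing and a column for
each region. It maps an assignment `u` of integers to the regions to the vector whose entry at the
crossing `x` is `∑ R, u R * A x R`. -/
def hom (D : LinkDiagram) {S : Type} [TopologicalSpace S] (e : ℂ → S)
    (A : Matrix D.Crossing (D.Region e) ℤ) : (D.Region e →₀ ℤ) →ₗ[ℤ] (D.Crossing → ℤ) :=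
  Finsupp.linearCombination ℤ (fun R x => A x R)

/-- The homomorphism of the definite problem with the single counting rule. -/
def PhiD1 (D : LinkDiagram) {S : Type} [TopologicalSpace S] (e : ℂ → S) :
    (D.Region e →₀ ℤ) →ₗ[ℤ] (D.Crossing → ℤ) := D.hom e (D.matrixD1 e)

/-- The homomorphism of the definite problem with the double counting rule. -/
def PhiD2 (D : LinkDiagram) {S : Type} [TopologicalSpace S] (e : ℂ → S) :
    (D.Region e →₀ ℤ) →ₗ[ℤ] (D.Crossing → ℤ) := D.hom e (D.matrixD2 e)

/-- The homomorphism of the alternating problem with the single counting rule. -/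
def PhiA1 (D : LinkDiagram) {S : Type} [TopologicalSpace S] (e : ℂ → S) :
    (D.Region e →₀ ℤ) →ₗ[ℤ] (D.Crossing → ℤ) := D.hom e (D.matrixA1 e)

/-- The homomorphism of the alternating problem with the double counting rule. -/
def PhiA2 (D : LinkDiagram) {S : Type} [TopologicalSpace S] (e : ℂ → S) :
    (D.Region e →₀ ℤ) →ₗ[ℤ] (D.Crossing → ℤ) := D.hom e (D.matrixA2 e)

/-- The inclusion of the plane into itself, used for diagrams on the plane. -/
def inPlane : ℂ → ℂ := id

/-- The inclusion of the plane into the sphere `S² = ℝ² ∪ {∞}`, used for diagrams on the sphere. -/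
def inSphere : ℂ → OnePoint ℂ := fun z => (z : OnePoint ℂ)

end LinkDiagram

end

/-! The definite and alternating problems are equivalent. The parity of the total winding number of
the link is a checkerboard colouring of the regions. Changing the signs of columns by colour, and of
rows by a sign at each crossing, turns the definite matrices into the alternating ones
(`exists_signs`), so only the alternating case needs an argument.

There, double counting is the natural rule: the value at a crossing is the signed sum of the labels
at its four corners (`PhiA2_apply`). The two rules differ only at crossings touched by one region at
two opposite corners; call these reducible. Both inclusions of images follow once the unit vector of
every reducible crossing `x` lies in both images (`single_mem_range`).

For double counting, let `R` be the region touching `x` twice. A loop through `x` inside `R`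
separates the other two corners at `x` and meets the link only at `x`. Label each region on the
inner side by its winding number minus that of `R`, and all other regions by `0`. Winding numbers
have signed corner sum zero at every crossing, even after subtracting a constant. A crossing other
than `x` lies wholly on one side of the loop, corners in `R` having the consistent label `0`, so its
value is `0`. At `x` exactly one corner contributes, and it contributes `±1`.

For single counting, induct on the number of crossings inside the loop. With the same labels, the
two rules differ only at reducible crossings `y` whose doubly touching region is inside and
different from `R`. The inside is the side avoiding a fixed base point of the link, and the loop of
`y` is disjoint from that of `x`; hence the inside of `y` contains strictly fewer crossings
(`exists_inside`).

No Jordan curve theorem is needed: separation is detected by winding numbers, which are locally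
constant off a curve and jump by one across a simple point (`eventually_winding_jump`). -/

open Set Filter

/-! ### Winding numbers of plane curves through continuous logarithms. -/

/-- Two continuous logarithms of the same function have the same change over an interval. -/
theorem sub_eq_sub_of_exp_eq {f g : ℝ → ℂ} {a b : ℝ} (hab : a ≤ b)
    (hf : ContinuousOn f (Icc a b)) (hg : ContinuousOn g (Icc a b))
    (h : ∀ t ∈ Icc a b, Complex.exp (f t) = Complex.exp (g t)) : f b - f a = g b - g a := by
  have hpi : (2 * Real.pi * Complex.I : ℂ) ≠ 0 := Complex.two_pi_I_ne_zero
  have key : ∀ t ∈ Icc a b, ∃ n : ℤ, f t - g t = n * (2 * Real.pi * Complex.I) := fun t ht => by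
    obtain ⟨n, hn⟩ := Complex.exp_eq_exp_iff_exists_int.1 (h t ht)
    exact ⟨n, by rw [hn]; ring⟩
  choose! n hn using key
  have hcont : ContinuousOn (fun t => ((n t : ℤ) : ℂ)) (Icc a b) := by
    refine ((hf.sub hg).div_const (2 * Real.pi * Complex.I)).congr fun t ht => ?_
    simp only [Pi.sub_apply, hn t ht]
    field_simp
  -- The two logarithms differ by an integer multiple of `2πi`; the integer depends continuously on
  -- the parameter, so it is constant.
  have hcont' : ContinuousOn n (Icc a b) := by
    have hre : ContinuousOn (fun t => ((n t : ℤ) : ℝ)) (Icc a b) :=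
      (Complex.continuous_re.comp_continuousOn hcont).congr fun t _ => by simp
    exact (Int.isClosedEmbedding_coe_real.isInducing.continuousOn_iff).2 hre
  have := isPreconnected_Icc.constant hcont' (left_mem_Icc.2 hab) (right_mem_Icc.2 hab)
  have h1 := hn a (left_mem_Icc.2 hab)
  have h2 := hn b (right_mem_Icc.2 hab)
  rw [this, ← h2] at h1
  linear_combination -h1

/-- `exp` is a covering of the punctured plane, and paths lift through coverings. -/
theorem exists_continuous_exp_eq {f : ℝ → ℂ} (hf : Continuous f) (h0 : ∀ t, f t ≠ 0) :
    ∃ θ : ℝ → ℂ, Continuous θ ∧ ∀ t, Complex.exp (θ t) = f t := by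
  obtain ⟨θ, ⟨-, hθ⟩, -⟩ := Complex.isCoveringMapOn_exp.existsUnique_continuousMap_lifts
    (A := ℝ) ⟨f, hf⟩ (a₀ := 0) (e₀ := Complex.log (f 0)) (Complex.exp_log (h0 0)) (fun t => h0 t)
  exact ⟨θ, θ.continuous, fun t => congrFun hθ t⟩

/-- `IsWinding ℓ a b p n`: along the interval `[a, b]` the curve `ℓ` winds `n` times around `p`. -/
def IsWinding (ℓ : ℝ → ℂ) (a b : ℝ) (p : ℂ) (n : ℤ) : Prop :=
  ∃ θ : ℝ → ℂ, Continuous θ ∧ (∀ t, Complex.exp (θ t) = ℓ t - p) ∧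
    θ b - θ a = n * (2 * Real.pi * Complex.I)

open Classical in
/-- The winding number of the curve `ℓ` along `[a, b]` around `p`. -/
noncomputable def winding (ℓ : ℝ → ℂ) (a b : ℝ) (p : ℂ) : ℤ :=
  if h : ∃ n, IsWinding ℓ a b p n then h.choose else 0

theorem IsWinding.unique {ℓ : ℝ → ℂ} {a b : ℝ} {p : ℂ} {m n : ℤ} (hab : a ≤ b)
    (hm : IsWinding ℓ a b p m) (hn : IsWinding ℓ a b p n) : m = n := by
  obtain ⟨θ, hθ, hexp, h⟩ := hm
  obtain ⟨ψ, hψ, hexp', h'⟩ := hn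
  have := sub_eq_sub_of_exp_eq hab hθ.continuousOn hψ.continuousOn
    (fun t _ => (hexp t).trans (hexp' t).symm)
  rw [h, h'] at this
  exact_mod_cast mul_right_cancel₀ Complex.two_pi_I_ne_zero this

theorem IsWinding.winding_eq {ℓ : ℝ → ℂ} {a b : ℝ} {p : ℂ} {n : ℤ} (hab : a ≤ b)
    (hn : IsWinding ℓ a b p n) : winding ℓ a b p = n := by
  have h : ∃ n, IsWinding ℓ a b p n := ⟨n, hn⟩
  rw [winding, dif_pos h]
  exact h.choose_spec.unique hab hn

theorem exists_isWinding {ℓ : ℝ → ℂ} (hℓ : Continuous ℓ) {a b : ℝ} (hab : ℓ a = ℓ b) {p : ℂ}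
    (hp : p ∉ range ℓ) : ∃ n, IsWinding ℓ a b p n := by
  obtain ⟨θ, hθ, hexp⟩ := exists_continuous_exp_eq (f := fun t => ℓ t - p) (by fun_prop)
    (fun t h => hp ⟨t, sub_eq_zero.1 h⟩)
  obtain ⟨n, hn⟩ := Complex.exp_eq_exp_iff_exists_int.1
    (show Complex.exp (θ b) = Complex.exp (θ a) by rw [hexp, hexp, hab])
  exact ⟨n, θ, hθ, hexp, by rw [hn]; ring⟩

theorem isWinding_winding {ℓ : ℝ → ℂ} (hℓ : Continuous ℓ) {a b : ℝ} (hab : ℓ a = ℓ b) {p : ℂ}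
    (hp : p ∉ range ℓ) : IsWinding ℓ a b p (winding ℓ a b p) := by
  have h := exists_isWinding hℓ hab hp
  rw [winding, dif_pos h]
  exact h.choose_spec

theorem mem_slitPlane_of_norm_sub_one_lt {z : ℂ} (h : ‖z - 1‖ < 1) : z ∈ Complex.slitPlane :=
  Complex.ball_one_subset_slitPlane (by simpa [dist_eq_norm] using h)

/-- For `q` closer to `p` than the curve is, `(ℓ - q) / (ℓ - p)` stays within distance `1` of `1`.
Adding its principal logarithm to a lift for `p` gives a lift for `q`, and this correction has equal
values at both ends. -/
theorem eventually_winding_eq {ℓ : ℝ → ℂ} (hℓ : Continuous ℓ) (hcl : IsClosed (range ℓ))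
    {a b : ℝ} (hle : a ≤ b) (hab : ℓ a = ℓ b) {p : ℂ} (hp : p ∉ range ℓ) :
    ∀ᶠ q in 𝓝 p, winding ℓ a b q = winding ℓ a b p := by
  obtain ⟨r, hr, hball⟩ := Metric.isOpen_iff.1 hcl.isOpen_compl p hp
  obtain ⟨θ, hθ, hexp, hn⟩ := isWinding_winding hℓ hab hp
  filter_upwards [Metric.ball_mem_nhds p hr] with q hq
  have hne : ∀ t, ℓ t - p ≠ 0 := fun t h => hp ⟨t, sub_eq_zero.1 h⟩
  have hfar : ∀ t, r ≤ ‖ℓ t - p‖ := fun t => by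
    by_contra! h
    exact hball (show ℓ t ∈ Metric.ball p r by rwa [Metric.mem_ball, dist_eq_norm]) ⟨t, rfl⟩
  have hslit : ∀ t, (ℓ t - q) / (ℓ t - p) ∈ Complex.slitPlane := fun t => by
    apply mem_slitPlane_of_norm_sub_one_lt
    have : (ℓ t - q) / (ℓ t - p) - 1 = (p - q) / (ℓ t - p) := by
      field_simp [hne t]; ring
    rw [this, norm_div, div_lt_one (hr.trans_le (hfar t))]
    refine lt_of_lt_of_le ?_ (hfar t)
    rwa [← dist_eq_norm, dist_comm]
  refine IsWinding.winding_eq hle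
    ⟨fun t => θ t + Complex.log ((ℓ t - q) / (ℓ t - p)), ?_, fun t => ?_, ?_⟩
  · refine hθ.add (continuous_iff_continuousAt.2 fun t => ?_)
    refine ContinuousAt.clog ?_ (hslit t)
    exact ContinuousAt.div (by fun_prop) (by fun_prop) (hne t)
  · rw [Complex.exp_add, hexp, Complex.exp_log (Complex.slitPlane_ne_zero (hslit t)),
      mul_div_cancel₀ _ (hne t)]
  · simp only [hab, ← hn]; ring

theorem continuousOn_winding {ℓ : ℝ → ℂ} (hℓ : Continuous ℓ) (hcl : IsClosed (range ℓ))
    {a b : ℝ} (hle : a ≤ b) (hab : ℓ a = ℓ b) :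
    ContinuousOn (winding ℓ a b) (range ℓ)ᶜ := fun _ hp =>
  (continuousAt_const.congr ((eventually_winding_eq hℓ hcl hle hab hp).mono
    fun _ h => h.symm)).continuousWithinAt

theorem winding_add_one {ℓ : ℝ → ℂ} (hℓ : Continuous ℓ) (hper : Function.Periodic ℓ 1)
    (a b : ℝ) {p : ℂ} (hp : p ∉ range ℓ) :
    winding ℓ a (a + 1) p = winding ℓ b (b + 1) p := by
  wlog hab : a ≤ b generalizing a b
  · exact (this b a (le_of_not_ge hab)).symm
  obtain ⟨θ, hθ, hexp, hn⟩ := isWinding_winding hℓ (hper a).symm hp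
  refine (IsWinding.winding_eq (by linarith) ⟨θ, hθ, hexp, ?_⟩).symm
  have := sub_eq_sub_of_exp_eq hab (f := θ) (g := fun t => θ (t + 1)) hθ.continuousOn
    (by fun_prop) (fun t _ => by rw [hexp, hexp, hper])
  rw [← hn]
  linear_combination -this

theorem Complex.log_neg_sub_log_of_im_pos {z : ℂ} (h : 0 < z.im) :
    Complex.log (-z) - Complex.log z = -(Real.pi * Complex.I) := by
  simp only [Complex.log, norm_neg, Complex.arg_neg_eq_arg_sub_pi_of_im_pos h]
  push_cast; ring

theorem Complex.log_neg_sub_log_of_im_neg {z : ℂ} (h : z.im < 0) :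
    Complex.log (-z) - Complex.log z = Real.pi * Complex.I := by
  simp only [Complex.log, norm_neg, Complex.arg_neg_eq_arg_add_pi_of_im_neg h]
  push_cast; ring

theorem eventually_sub_mul_neg {g : ℝ → ℝ} {c τ : ℝ} (hg : HasDerivAt g c τ) (h0 : g τ = 0)
    (hc : c < 0) : ∀ᶠ t in 𝓝[≠] τ, (t - τ) * g t < 0 := by
  filter_upwards [(hasDerivAt_iff_tendsto_slope.1 hg).eventually_lt_const hc,
    self_mem_nhdsWithin] with t ht hne
  have hne' : t - τ ≠ 0 := sub_ne_zero.2 hne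
  rw [slope_def_field, h0, sub_zero] at ht
  have : (t - τ) * g t = (g t / (t - τ)) * (t - τ) ^ 2 := by field_simp
  rw [this]
  exact mul_neg_of_neg_of_pos ht (by positivity)

/-- The winding number increases by one when a curve is crossed from its right to its left. -/
theorem eventually_winding_jump {ℓ : ℝ → ℂ} (hℓ : Continuous ℓ) {a b τ : ℝ} (hab : ℓ a = ℓ b)
    (haτ : a < τ) (hτb : τ < b) (hsimple : ∀ t ∈ Icc a b, ℓ t = ℓ τ → t = τ) {v u : ℂ}
    (hv : HasDerivAt ℓ v τ) (hvu : 0 < planeDet v u) :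
    ∀ᶠ ε : ℝ in 𝓝[>] 0, ℓ τ + ε • u ∉ range ℓ → ℓ τ - ε • u ∉ range ℓ →
      winding ℓ a b (ℓ τ + ε • u) = winding ℓ a b (ℓ τ - ε • u) + 1 := by
  have hu : u ≠ 0 := by rintro rfl; simp [planeDet] at hvu
  -- Coordinates in which the simple point is `0` and `u` is `1`: the two test points become `ε` and
  -- `-ε`, and the curve crosses the real axis downwards at `τ`.
  set ζ : ℝ → ℂ := fun t => (ℓ t - ℓ τ) / u with hζ
  have hζc : Continuous ζ := by fun_prop
  have hζτ : ζ τ = 0 := by simp [hζ]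
  have hder : HasDerivAt (fun t => (ζ t).im) (v / u).im τ := by
    have := (hv.sub_const (ℓ τ)).div_const u
    exact (Complex.imCLM.hasFDerivAt.comp_hasDerivAt τ this)
  have hneg : (v / u).im < 0 := by
    have hn : 0 < Complex.normSq u := Complex.normSq_pos.2 hu
    rw [Complex.div_im, ← sub_div]
    apply div_neg_of_neg_of_pos _ hn
    rw [planeDet] at hvu
    linarith
  have hev := eventually_sub_mul_neg hder (by simp [hζτ]) hneg
  rw [eventually_nhdsWithin_iff, Metric.eventually_nhds_iff] at hev
  obtain ⟨h₀, hh₀, hsign⟩ := hev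
  obtain ⟨h, hh, hha, hhb, hhh⟩ : ∃ h > 0, h < τ - a ∧ h < b - τ ∧ h < h₀ := by
    obtain ⟨h, h1, h2⟩ := exists_between (lt_min (lt_min (sub_pos.2 haτ) (sub_pos.2 hτb)) hh₀)
    simp only [lt_min_iff] at h2
    exact ⟨h, h1, h2.1.1, h2.1.2, h2.2⟩
  have hpos : ∀ t, t ≠ τ → |t - τ| ≤ h → (t - τ) * (ζ t).im < 0 := fun t ht hle =>
    hsign (by rw [Real.dist_eq]; linarith) ht
  obtain ⟨m, hm, hfar⟩ : ∃ m > 0, ∀ t ∈ Icc a (τ - h) ∪ Icc (τ + h) b, m ≤ ‖ζ t‖ := by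
    have hcomp : IsCompact (Icc a (τ - h) ∪ Icc (τ + h) b) := isCompact_Icc.union isCompact_Icc
    obtain ⟨t₀, ht₀, hmin⟩ := hcomp.exists_isMinOn
      ⟨a, Or.inl ⟨le_rfl, by linarith⟩⟩ hζc.norm.continuousOn
    refine ⟨‖ζ t₀‖, norm_pos_iff.2 fun h0 => ?_, fun t ht => hmin ht⟩
    have h1 : ℓ t₀ = ℓ τ := by
      rcases div_eq_zero_iff.1 h0 with h2 | h2
      · exact sub_eq_zero.1 h2
      · exact absurd h2 hu
    have h3 : t₀ = τ := hsimple t₀ (by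
      rcases ht₀ with h4 | h4
      · exact ⟨h4.1, by linarith [h4.2]⟩
      · exact ⟨by linarith [h4.1], h4.2⟩) h1
    subst h3
    rcases ht₀ with h4 | h4
    · linarith [h4.2]
    · linarith [h4.1]
  -- The bound `m / 3` gives `‖ζ t + ε‖ > 2 * ε` away from `τ`, which keeps `ρ` within distance `1`
  -- of `1` there.
  filter_upwards [self_mem_nhdsWithin,
    nhdsWithin_le_nhds (Iio_mem_nhds (show (0 : ℝ) < m / 3 by positivity))] with ε hε hεm hp hq
  have hε : 0 < ε := hε
  have hεm : ε < m / 3 := hεm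
  obtain ⟨θ, hθ, hθe, hθn⟩ := isWinding_winding hℓ hab hp
  obtain ⟨ψ, hψ, hψe, hψn⟩ := isWinding_winding hℓ hab hq
  have hplus : ∀ t, ζ t + ε ≠ 0 := fun t h0 => hq ⟨t, by
    simp only [hζ] at h0
    field_simp at h0
    rw [Complex.real_smul]
    linear_combination h0⟩
  set ρ : ℝ → ℂ := fun t => (ζ t - ε) / (ζ t + ε) with hρ
  have hρc : Continuous ρ := by
    refine continuous_iff_continuousAt.2 fun t => ?_
    exact ContinuousAt.div (by fun_prop) (by fun_prop) (hplus t)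
  have hexp : ∀ t, Complex.exp (θ t - ψ t) = ρ t := fun t => by
    have h1 : ℓ t - (ℓ τ + ε • u) = (ζ t - ε) * u := by
      simp only [hζ, Complex.real_smul]; field_simp; ring
    have h2 : ℓ t - (ℓ τ - ε • u) = (ζ t + ε) * u := by
      simp only [hζ, Complex.real_smul]; field_simp; ring
    rw [Complex.exp_sub, hθe, hψe, h1, h2, mul_div_mul_right _ _ hu]
  have hρim : ∀ t, (ρ t).im = 2 * ε * (ζ t).im / Complex.normSq (ζ t + ε) := fun t => by
    rw [hρ, Complex.div_im, ← sub_div]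
    congr 1
    simp only [Complex.sub_im, Complex.add_im, Complex.sub_re, Complex.add_re, Complex.ofReal_im,
      Complex.ofReal_re]
    ring
  have hnsq : ∀ t, 0 < Complex.normSq (ζ t + ε) := fun t => Complex.normSq_pos.2 (hplus t)
  have hfarslit : ∀ t ∈ Icc a (τ - h) ∪ Icc (τ + h) b, ρ t ∈ Complex.slitPlane := fun t ht => by
    apply mem_slitPlane_of_norm_sub_one_lt
    have h1 : ρ t - 1 = -(2 * ε) / (ζ t + ε) := by
      rw [hρ]; field_simp [hplus t]; ring
    have h2 : ‖(-(2 * ε) : ℂ)‖ = 2 * ε := by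
      rw [norm_neg, norm_mul, Complex.norm_real, Real.norm_of_nonneg hε.le]; simp
    rw [h1, norm_div, h2, div_lt_one (norm_pos_iff.2 (hplus t))]
    have h3 := norm_sub_le (ζ t + ε) ε
    rw [add_sub_cancel_right, Complex.norm_real, Real.norm_of_nonneg hε.le] at h3
    linarith [hfar t ht]
  -- Near `τ` the quotient `ρ` passes through `-1`, where the principal logarithm is discontinuous,
  -- so `log (-ρ) + πi` is used instead.
  have hnear : ∀ t ∈ Icc (τ - h) (τ + h), -ρ t ∈ Complex.slitPlane := fun t ht => by
    by_cases htτ : t = τ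
    · subst htτ
      have hε' : (ε : ℂ) ≠ 0 := by exact_mod_cast hε.ne'
      have : -ρ t = 1 := by simp [hρ, hζτ, hε']
      rw [this]; exact Complex.one_mem_slitPlane
    · refine Or.inr ?_
      rw [Complex.neg_im, hρim, neg_ne_zero]
      have := hpos t htτ (abs_le.2 ⟨by linarith [ht.1], by linarith [ht.2]⟩)
      have h4 : (ζ t).im ≠ 0 := by rintro h5; simp [h5] at this
      exact div_ne_zero (by positivity) (hnsq t).ne'
  have hφ : Continuous fun t => θ t - ψ t := by fun_prop
  have hfarc : ∀ s ⊆ Icc a (τ - h) ∪ Icc (τ + h) b,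
      ContinuousOn (fun t => Complex.log (ρ t)) s := fun s hs =>
    hρc.continuousOn.clog fun t ht => hfarslit t (hs ht)
  have e1 := sub_eq_sub_of_exp_eq (show a ≤ τ - h by linarith) hφ.continuousOn
    (hfarc _ subset_union_left) fun t ht => by
      rw [hexp, Complex.exp_log (Complex.slitPlane_ne_zero (hfarslit t (Or.inl ht)))]
  have e2 := sub_eq_sub_of_exp_eq (show τ - h ≤ τ + h by linarith) hφ.continuousOn
    (g := fun t => Complex.log (-ρ t) + Real.pi * Complex.I)
    ((hρc.neg.continuousOn.clog hnear).add continuousOn_const) fun t ht => by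
      rw [hexp, Complex.exp_add, Complex.exp_log (Complex.slitPlane_ne_zero (hnear t ht)),
        Complex.exp_pi_mul_I]
      ring
  have e3 := sub_eq_sub_of_exp_eq (show τ + h ≤ b by linarith) hφ.continuousOn
    (hfarc _ subset_union_right) fun t ht => by
      rw [hexp, Complex.exp_log (Complex.slitPlane_ne_zero (hfarslit t (Or.inr ht)))]
  have e4 := Complex.log_neg_sub_log_of_im_neg (z := ρ (τ + h)) (by
    rw [hρim]
    have := hpos (τ + h) (by linarith) (by rw [add_sub_cancel_left, abs_of_pos hh])
    rw [add_sub_cancel_left] at this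
    exact div_neg_of_neg_of_pos (by nlinarith) (hnsq _))
  have e5 := Complex.log_neg_sub_log_of_im_pos (z := ρ (τ - h)) (by
    rw [hρim]
    have := hpos (τ - h) (by linarith) (by rw [sub_sub_cancel_left, abs_neg, abs_of_pos hh])
    rw [sub_sub_cancel_left] at this
    exact div_pos (by nlinarith) (hnsq _))
  have e6 : ρ a = ρ b := by simp only [hρ, hζ, hab]
  -- Over the three intervals the logarithms telescope, except for the changes of branch at `τ - h`
  -- and `τ + h`, each of which contributes `πi`.
  have key : ((winding ℓ a b (ℓ τ + ε • u) : ℤ) : ℂ) * (2 * Real.pi * Complex.I) =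
      ((winding ℓ a b (ℓ τ - ε • u) + 1 : ℤ) : ℂ) * (2 * Real.pi * Complex.I) := by
    rw [e6] at e1
    push_cast
    rw [add_mul, ← hθn, ← hψn]
    linear_combination e1 + e2 + e3 + e4 - e5
  exact_mod_cast mul_right_cancel₀ Complex.two_pi_I_ne_zero key

/-! ### Determinants and linear coordinates in the plane. -/

theorem planeDet_swap (z w : ℂ) : planeDet w z = -planeDet z w := by
  simp only [planeDet]; ring

theorem planeDet_neg_right (z w : ℂ) : planeDet z (-w) = -planeDet z w := by
  simp only [planeDet, Complex.neg_re, Complex.neg_im]; ring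

theorem planeDet_smul_smul (a b : ℝ) (z w : ℂ) :
    planeDet (a • z) (b • w) = a * b * planeDet z w := by
  simp only [planeDet, Complex.real_smul, Complex.mul_re, Complex.mul_im, Complex.ofReal_re,
    Complex.ofReal_im]
  ring

/-- The linear coordinates of the plane with respect to two independent vectors. -/
noncomputable def planeEquiv (v u : ℂ) (h : planeDet v u ≠ 0) : (ℝ × ℝ) ≃L[ℝ] ℂ :=
  LinearEquiv.toContinuousLinearEquiv
    { toFun := fun z => z.1 • v + z.2 • u
      map_add' := fun z w => by simp only [Prod.fst_add, Prod.snd_add, add_smul]; ring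
      map_smul' := fun c z => by simp [mul_smul, smul_add]
      invFun := fun w => (planeDet w u / planeDet v u, planeDet v w / planeDet v u)
      left_inv := fun z => by
        ext
        · simp only
          rw [div_eq_iff h]
          simp only [planeDet, Complex.add_re, Complex.add_im, Complex.real_smul, Complex.mul_re,
            Complex.mul_im, Complex.ofReal_re, Complex.ofReal_im]
          ring
        · simp only
          rw [div_eq_iff h]
          simp only [planeDet, Complex.add_re, Complex.add_im, Complex.real_smul, Complex.mul_re,
            Complex.mul_im, Complex.ofReal_re, Complex.ofReal_im]
          ring
      right_inv := fun w => by
        apply Complex.ext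
        · simp only [Complex.add_re, Complex.real_smul, Complex.mul_re,
            Complex.ofReal_re, Complex.ofReal_im]
          field_simp
          simp only [planeDet]
          ring
        · simp only [Complex.add_im, Complex.real_smul, Complex.mul_im,
            Complex.ofReal_re, Complex.ofReal_im]
          field_simp
          simp only [planeDet]
          ring }

theorem planeEquiv_apply (v u : ℂ) (h : planeDet v u ≠ 0) (z : ℝ × ℝ) :
    planeEquiv v u h z = z.1 • v + z.2 • u := rfl

/-! ### Periodic parameters and charts at double points. -/

namespace LinkDiagram

variable (D : LinkDiagram)

/-- Two real parameters describe the same point of the link. -/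
def SamePt (i : Fin D.numComponents) (s : ℝ) (j : Fin D.numComponents) (t : ℝ) : Prop :=
  i = j ∧ ∃ n : ℤ, s = t + n

variable {D}

theorem SamePt.symm {i j : Fin D.numComponents} {s t : ℝ} (h : D.SamePt i s j t) :
    D.SamePt j t i s := by
  obtain ⟨rfl, n, rfl⟩ := h
  exact ⟨rfl, -n, by push_cast; ring⟩

theorem SamePt.trans {i j l : Fin D.numComponents} {s t r : ℝ} (h : D.SamePt i s j t)
    (h' : D.SamePt j t l r) : D.SamePt i s l r := by
  obtain ⟨rfl, n, rfl⟩ := h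
  obtain ⟨rfl, m, rfl⟩ := h'
  exact ⟨rfl, m + n, by push_cast; ring⟩

variable (D)

theorem curve_add_int (i : Fin D.numComponents) (t : ℝ) (n : ℤ) :
    D.curve i (t + n) = D.curve i t := by
  simpa using (D.periodic_curve i).int_mul n t

theorem deriv_curve_add_int (i : Fin D.numComponents) (t : ℝ) (n : ℤ) :
    deriv (D.curve i) (t + n) = deriv (D.curve i) t := by
  have : (fun r => D.curve i (r + n)) = D.curve i := funext fun r => D.curve_add_int i r n
  rw [← deriv_comp_add_const, this]

/-- The parameter in the fundamental interval of the point of the link with a real parameter. -/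
noncomputable def toParam (i : Fin D.numComponents) (t : ℝ) : D.Param :=
  (i, ⟨Int.fract t, Int.fract_nonneg t, Int.fract_lt_one t⟩)

theorem curve_fract (i : Fin D.numComponents) (t : ℝ) :
    D.curve i (Int.fract t) = D.curve i t := by
  conv_rhs => rw [← Int.fract_add_floor t]
  rw [curve_add_int]

theorem deriv_curve_fract (i : Fin D.numComponents) (t : ℝ) :
    deriv (D.curve i) (Int.fract t) = deriv (D.curve i) t := by
  conv_rhs => rw [← Int.fract_add_floor t]
  rw [deriv_curve_add_int]

theorem toParam_eq_iff {i j : Fin D.numComponents} {s t : ℝ} :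
    D.toParam i s = D.toParam j t ↔ D.SamePt i s j t := by
  rw [Prod.ext_iff, Subtype.ext_iff]
  change i = j ∧ Int.fract s = Int.fract t ↔ _
  rw [Int.fract_eq_fract]
  refine and_congr Iff.rfl (exists_congr fun n => ?_)
  constructor <;> intro h <;> linarith

theorem planeDet_deriv_ne_zero {i j : Fin D.numComponents} {s t : ℝ}
    (h : D.curve i s = D.curve j t) (hne : ¬ D.SamePt i s j t) :
    planeDet (deriv (D.curve i) s) (deriv (D.curve j) t) ≠ 0 := by
  have := D.transverse (D.toParam i s) (D.toParam j t) (fun h' => hne (D.toParam_eq_iff.1 h'))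
    (by simpa only [toParam, curve_fract] using h)
  simpa only [toParam, deriv_curve_fract] using this

theorem samePt_of_triple {i j l : Fin D.numComponents} {s t r : ℝ}
    (h : D.curve i s = D.curve j t) (hne : ¬ D.SamePt i s j t) (h' : D.curve l r = D.curve i s) :
    D.SamePt l r i s ∨ D.SamePt l r j t := by
  have := D.at_most_double (D.toParam l r) (D.toParam i s) (D.toParam j t)
    (by simpa only [toParam, curve_fract] using h') (by simpa only [toParam, curve_fract] using h)
  simp only [toParam_eq_iff] at this
  tauto

theorem continuous_curve (i : Fin D.numComponents) : Continuous (D.curve i) :=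
  (D.contDiff_curve i).continuous

theorem hasDerivAt_curve (i : Fin D.numComponents) (t : ℝ) :
    HasDerivAt (D.curve i) (deriv (D.curve i) t) t :=
  ((D.contDiff_curve i).differentiable (by simp)).differentiableAt.hasDerivAt

theorem continuous_deriv_curve (i : Fin D.numComponents) : Continuous (deriv (D.curve i)) :=
  (D.contDiff_curve i).continuous_deriv (by simp)

theorem isCompact_range_curve (i : Fin D.numComponents) : IsCompact (range (D.curve i)) := by
  have : range (D.curve i) = D.curve i '' Icc 0 1 := by
    refine Subset.antisymm ?_ (image_subset_range _ _)
    rintro _ ⟨t, rfl⟩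
    exact ⟨Int.fract t, ⟨Int.fract_nonneg t, (Int.fract_lt_one t).le⟩, D.curve_fract i t⟩
  rw [this]
  exact isCompact_Icc.image (D.continuous_curve i)

theorem image_eq : D.image = ⋃ i, range (D.curve i) := by
  ext z
  simp only [image, mem_range, mem_iUnion]
  constructor
  · rintro ⟨p, rfl⟩; exact ⟨p.1, p.2, rfl⟩
  · rintro ⟨i, t, rfl⟩; exact ⟨D.toParam i t, D.curve_fract i t⟩

theorem mem_image_iff {z : ℂ} : z ∈ D.image ↔ ∃ i t, D.curve i t = z := by
  simp [image_eq]

theorem isCompact_image : IsCompact D.image := by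
  rw [image_eq]; exact isCompact_iUnion fun i => D.isCompact_range_curve i

/-- Near a double point the image consists of points whose parameters are close to those of the
double point. -/
theorem eventually_near_of_double {i j : Fin D.numComponents} {s t : ℝ}
    (h : D.curve i s = D.curve j t) (hne : ¬ D.SamePt i s j t) {δ : ℝ} (hδ : 0 < δ) :
    ∀ᶠ z in 𝓝 (D.curve i s), ∀ l r, D.curve l r = z →
      (l = i ∧ ∃ n : ℤ, |r - s - n| < δ) ∨ (l = j ∧ ∃ n : ℤ, |r - t - n| < δ) := by
  rw [eventually_all]
  intro l
  set A : Set ℝ := {r | (l = i ∧ ∃ n : ℤ, |r - s - n| < δ) ∨ (l = j ∧ ∃ n : ℤ, |r - t - n| < δ)}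
    with hA
  have hopen : ∀ c : ℝ, IsOpen {r : ℝ | ∃ n : ℤ, |r - c - n| < δ} := fun c => by
    simp only [ofPred_exists]
    exact isOpen_iUnion fun n => isOpen_lt (by fun_prop) continuous_const
  have hAo : IsOpen A := by
    have h1 := (isOpen_const (p := l = i)).and (hopen s)
    have h2 := (isOpen_const (p := l = j)).and (hopen t)
    exact h1.union h2
  have hcomp : IsCompact (D.curve l '' (Icc 0 1 \ A)) :=
    (isCompact_Icc.diff hAo).image (D.continuous_curve l)
  have hx : D.curve i s ∉ D.curve l '' (Icc 0 1 \ A) := by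
    rintro ⟨r, ⟨-, hr⟩, hrs⟩
    apply hr
    rcases D.samePt_of_triple h hne hrs with ⟨hl, n, hn⟩ | ⟨hl, n, hn⟩
    · exact Or.inl ⟨hl, n, by rw [hn]; simpa using hδ⟩
    · exact Or.inr ⟨hl, n, by rw [hn]; simpa using hδ⟩
  filter_upwards [hcomp.isClosed.isOpen_compl.mem_nhds hx] with z hz r hr
  by_contra hcon
  refine hz ⟨Int.fract r, ⟨⟨Int.fract_nonneg r, (Int.fract_lt_one r).le⟩, fun hmem => hcon ?_⟩,
    (D.curve_fract l r).trans hr⟩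
  have hsub : ∀ (c : ℝ) (n : ℤ), Int.fract r - c - n = r - c - ((n + ⌊r⌋ : ℤ) : ℝ) := fun c n => by
    rw [Int.fract]; push_cast; ring
  rcases hmem with ⟨hl, n, hn⟩ | ⟨hl, n, hn⟩
  · exact Or.inl ⟨hl, n + ⌊r⌋, by rwa [← hsub]⟩
  · exact Or.inr ⟨hl, n + ⌊r⌋, by rwa [← hsub]⟩

/-- The sum of two strands through a double point, as a map from the plane of their parameters. -/
noncomputable def strandMap (i : Fin D.numComponents) (s : ℝ) (j : Fin D.numComponents) (t : ℝ)
    (z : ℝ × ℝ) : ℂ :=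
  D.curve i (s + z.1) + D.curve j (t + z.2) - D.curve i s

theorem hasFDerivAt_strandMap (i : Fin D.numComponents) (s : ℝ) (j : Fin D.numComponents) (t : ℝ)
    (z : ℝ × ℝ)
    (h : planeDet (deriv (D.curve i) (s + z.1)) (deriv (D.curve j) (t + z.2)) ≠ 0) :
    HasFDerivAt (D.strandMap i s j t) (planeEquiv _ _ h : ℝ × ℝ →L[ℝ] ℂ) z := by
  have h1 : HasFDerivAt (fun z : ℝ × ℝ => D.curve i (s + z.1)) _ z :=
    (D.hasDerivAt_curve i (s + z.1)).hasFDerivAt.comp z (hasFDerivAt_fst.const_add s)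
  have h2 : HasFDerivAt (fun z : ℝ × ℝ => D.curve j (t + z.2)) _ z :=
    (D.hasDerivAt_curve j (t + z.2)).hasFDerivAt.comp z (hasFDerivAt_snd.const_add t)
  refine ((h1.add h2).sub_const (D.curve i s)).congr_fderiv ?_
  ext <;> simp [planeEquiv_apply]

theorem contDiff_strandMap (i : Fin D.numComponents) (s : ℝ) (j : Fin D.numComponents) (t : ℝ) :
    ContDiff ℝ ∞ (D.strandMap i s j t) := by
  have h1 := D.contDiff_curve i
  have h2 := D.contDiff_curve j
  unfold strandMap
  fun_prop

/-- A chart around a double point in which the two strands are the coordinate axes. -/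
structure Chart (D : LinkDiagram) (i : Fin D.numComponents) (s : ℝ) (j : Fin D.numComponents)
    (t : ℝ) where
  /-- the coordinate map -/
  φ : OpenPartialHomeomorph (ℝ × ℝ) ℂ
  /-- the size of the chart -/
  δ : ℝ
  δ_pos : 0 < δ
  coe_eq : ∀ z, φ z = D.strandMap i s j t z
  ball_subset : Metric.ball 0 δ ⊆ φ.source
  axes : ∀ z ∈ Metric.ball (0 : ℝ × ℝ) δ, ∀ l r, D.curve l r = φ z →
    (z.2 = 0 ∧ D.SamePt l r i (s + z.1)) ∨ (z.1 = 0 ∧ D.SamePt l r j (t + z.2))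
  det_pos : ∀ z ∈ Metric.ball (0 : ℝ × ℝ) δ,
    0 < planeDet (deriv (D.curve i) s) (deriv (D.curve j) t) *
      planeDet (deriv (D.curve i) (s + z.1)) (deriv (D.curve j) (t + z.2))

theorem mem_ball_zero_prod {δ : ℝ} {z : ℝ × ℝ} :
    z ∈ Metric.ball (0 : ℝ × ℝ) δ ↔ |z.1| < δ ∧ |z.2| < δ := by
  rw [mem_ball_zero_iff, Prod.norm_def, max_lt_iff, Real.norm_eq_abs, Real.norm_eq_abs]

/-- Transversality makes the derivative of `strandMap` at the origin invertible, so the inverse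
function theorem applies. Link points near the double point have parameters near `s` or `t`; they
are therefore images of points on the axes, and injectivity leaves no other preimage in the ball. -/
theorem nonempty_chart {i j : Fin D.numComponents} {s t : ℝ}
    (h : D.curve i s = D.curve j t) (hne : ¬ D.SamePt i s j t) : Nonempty (D.Chart i s j t) := by
  have hdet := D.planeDet_deriv_ne_zero h hne
  have hdet0 : planeDet (deriv (D.curve i) (s + (0 : ℝ × ℝ).1))
      (deriv (D.curve j) (t + (0 : ℝ × ℝ).2)) ≠ 0 := by simpa using hdet
  set φ := (D.contDiff_strandMap i s j t).contDiffAt.toOpenPartialHomeomorph _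
    (D.hasFDerivAt_strandMap i s j t 0 hdet0) (by simp)
  have hφ : ∀ z, φ z = D.strandMap i s j t z := fun z => rfl
  have hφ0 : D.strandMap i s j t 0 = D.curve i s := by simp [strandMap, h]
  have hsrc : φ.source ∈ 𝓝 (0 : ℝ × ℝ) := φ.open_source.mem_nhds
    ((D.contDiff_strandMap i s j t).contDiffAt.mem_toOpenPartialHomeomorph_source
      (D.hasFDerivAt_strandMap i s j t 0 hdet0) (by simp))
  obtain ⟨δ₀, hδ₀, hball⟩ := Metric.mem_nhds_iff.1 hsrc
  have hnear := D.eventually_near_of_double h hne hδ₀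
  rw [← hφ0] at hnear
  have hcont : Continuous (D.strandMap i s j t) := (D.contDiff_strandMap i s j t).continuous
  have hdetc : Continuous fun z : ℝ × ℝ => planeDet (deriv (D.curve i) s) (deriv (D.curve j) t) *
      planeDet (deriv (D.curve i) (s + z.1)) (deriv (D.curve j) (t + z.2)) := by
    have h1 := D.continuous_deriv_curve i
    have h2 := D.continuous_deriv_curve j
    unfold planeDet
    fun_prop
  have hdete := (hdetc.tendsto 0).eventually_const_lt (u := 0)
    (by simpa only [Prod.fst_zero, Prod.snd_zero, add_zero] using mul_self_pos.2 hdet)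
  obtain ⟨δ₁, hδ₁, hball₁⟩ := Metric.eventually_nhds_iff_ball.1
    ((hcont.continuousAt.eventually hnear).and hdete)
  refine ⟨⟨φ, min δ₀ δ₁, lt_min hδ₀ hδ₁, hφ,
    (Metric.ball_subset_ball (min_le_left _ _)).trans hball, fun z hz l r hlr => ?_,
    fun z hz => (hball₁ z (Metric.ball_subset_ball (min_le_right _ _) hz)).2⟩⟩
  have hz₀ : z ∈ φ.source := hball (Metric.ball_subset_ball (min_le_left _ _) hz)
  have hbs : ∀ w : ℝ × ℝ, |w.1| < δ₀ → |w.2| < δ₀ → φ w = φ z → w = z := fun w h1 h2 h3 =>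
    φ.injOn (hball (mem_ball_zero_prod.2 ⟨h1, h2⟩)) hz₀ h3
  rcases (hball₁ z (Metric.ball_subset_ball (min_le_right _ _) hz)).1 l r hlr with
    ⟨rfl, n, hn⟩ | ⟨rfl, n, hn⟩
  · have hw := hbs (r - s - n, 0) hn (by simpa using hδ₀) (by
      rw [← hlr, hφ]
      have : s + (r - s - n) = r + ((-n : ℤ) : ℝ) := by push_cast; ring
      simp only [strandMap, add_zero, this, curve_add_int, h]
      ring)
    rw [← hw]
    exact Or.inl ⟨rfl, rfl, n, by ring⟩
  · have hw := hbs (0, r - t - n) (by simpa using hδ₀) hn (by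
      rw [← hlr, hφ]
      have : t + (r - t - n) = r + ((-n : ℤ) : ℝ) := by push_cast; ring
      simp only [strandMap, add_zero, this, curve_add_int]
      ring)
    rw [← hw]
    exact Or.inr ⟨rfl, rfl, n, by ring⟩

end LinkDiagram

/-! ### The total winding number and its jump across a strand. -/

namespace LinkDiagram

variable (D : LinkDiagram)

/-- The sum of the winding numbers of the components of a link diagram around a point. -/
noncomputable def totalWinding (z : ℂ) : ℤ := ∑ i, winding (D.curve i) 0 1 z

theorem curve_zero_eq_one (i : Fin D.numComponents) : D.curve i 0 = D.curve i 1 := by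
  simpa using (D.periodic_curve i 0).symm

theorem continuousOn_totalWinding : ContinuousOn D.totalWinding D.imageᶜ := by
  refine continuousOn_finsetSum _ fun i _ => ?_
  refine (continuousOn_winding (D.continuous_curve i) (D.isCompact_range_curve i).isClosed
    zero_le_one (D.curve_zero_eq_one i)).mono (compl_subset_compl.2 ?_)
  rw [image_eq]
  exact subset_iUnion (fun i => range (D.curve i)) i

theorem tendsto_add_smul (x u : ℂ) :
    Tendsto (fun ε : ℝ => x + ε • u) (𝓝[>] 0) (𝓝 x) := by
  have : Continuous fun ε : ℝ => x + ε • u := by fun_prop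
  simpa using (this.tendsto 0).mono_left nhdsWithin_le_nhds

theorem tendsto_sub_smul (x u : ℂ) :
    Tendsto (fun ε : ℝ => x - ε • u) (𝓝[>] 0) (𝓝 x) := by
  have : Continuous fun ε : ℝ => x - ε • u := by fun_prop
  simpa using (this.tendsto 0).mono_left nhdsWithin_le_nhds

/-- Only the component through the simple point jumps; the winding numbers of the others are locally
constant there. -/
theorem eventually_totalWinding_jump_of_pos {i : Fin D.numComponents} {τ : ℝ}
    (hsimple : ∀ l r, D.curve l r = D.curve i τ → D.SamePt l r i τ) {u : ℂ}
    (hu : 0 < planeDet (deriv (D.curve i) τ) u) :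
    ∀ᶠ ε : ℝ in 𝓝[>] 0, D.curve i τ + ε • u ∉ D.image → D.curve i τ - ε • u ∉ D.image →
      D.totalWinding (D.curve i τ + ε • u) = D.totalWinding (D.curve i τ - ε • u) + 1 := by
  -- The period is centred at `τ`, so that `τ` is interior and no other integer translate of it lies
  -- in the interval.
  have hself := eventually_winding_jump (D.continuous_curve i) (a := τ - 1 / 2)
    (b := τ - 1 / 2 + 1) (τ := τ) (D.periodic_curve i _).symm (by linarith) (by linarith)
    (fun t ht h => by
      obtain ⟨-, n, hn⟩ := hsimple i t h
      have h1 : ((n : ℤ) : ℝ) < 1 := by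
        linarith [ht.2, (show t ≤ τ + 1 / 2 by linarith [ht.2])]
      have h2 : (-1 : ℝ) < n := by linarith [ht.1]
      have h3 : n < 1 := by exact_mod_cast h1
      have h4 : -1 < n := by exact_mod_cast h2
      have h5 : n = 0 := by omega
      rw [hn, h5]; simp) (D.hasDerivAt_curve i τ) hu
  have hother : ∀ l, l ≠ i → ∀ᶠ ε : ℝ in 𝓝[>] 0,
      winding (D.curve l) 0 1 (D.curve i τ + ε • u) =
        winding (D.curve l) 0 1 (D.curve i τ - ε • u) := fun l hl => by
    have hev := eventually_winding_eq (D.continuous_curve l) (D.isCompact_range_curve l).isClosed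
      zero_le_one (D.curve_zero_eq_one l) (p := D.curve i τ)
      (fun ⟨r, hr⟩ => hl (hsimple l r hr).1)
    filter_upwards [(tendsto_add_smul _ u).eventually hev, (tendsto_sub_smul _ u).eventually hev]
      with ε h1 h2 using h1.trans h2.symm
  have hother' : ∀ᶠ ε : ℝ in 𝓝[>] 0, ∀ l, l ≠ i → winding (D.curve l) 0 1 (D.curve i τ + ε • u) =
        winding (D.curve l) 0 1 (D.curve i τ - ε • u) := by
    rw [eventually_all]
    intro l
    by_cases hl : l = i
    · simp [hl]
    · simpa [hl] using hother l hl
  filter_upwards [hself, hother'] with ε h1 h2 hp hq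
  have hrange : ∀ {z}, z ∉ D.image → z ∉ range (D.curve i) := fun hz ⟨r, hr⟩ =>
    hz (D.mem_image_iff.2 ⟨i, r, hr⟩)
  have hrot : ∀ {z}, z ∉ D.image → winding (D.curve i) 0 1 z =
      winding (D.curve i) (τ - 1 / 2) (τ - 1 / 2 + 1) z := fun hz => by
    simpa using winding_add_one (D.continuous_curve i) (D.periodic_curve i) 0 (τ - 1 / 2)
      (hrange hz)
  rw [totalWinding, totalWinding, ← Finset.add_sum_erase _ _ (Finset.mem_univ i),
    ← Finset.add_sum_erase Finset.univ (fun l => winding (D.curve l) 0 1 (D.curve i τ - ε • u))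
      (Finset.mem_univ i),
    Finset.sum_congr rfl fun l hl => h2 l (Finset.ne_of_mem_erase hl), hrot hp, hrot hq,
    h1 (hrange hp) (hrange hq)]
  ring

theorem eventually_totalWinding_jump {i : Fin D.numComponents} {τ : ℝ}
    (hsimple : ∀ l r, D.curve l r = D.curve i τ → D.SamePt l r i τ) {u : ℂ}
    (hu : planeDet (deriv (D.curve i) τ) u ≠ 0) :
    ∀ᶠ ε : ℝ in 𝓝[>] 0, D.curve i τ + ε • u ∉ D.image → D.curve i τ - ε • u ∉ D.image →
      D.totalWinding (D.curve i τ + ε • u) - D.totalWinding (D.curve i τ - ε • u) =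
        SignType.sign (planeDet (deriv (D.curve i) τ) u) := by
  rcases hu.lt_or_gt with h | h
  · have := D.eventually_totalWinding_jump_of_pos hsimple (u := -u)
      (by rw [planeDet_neg_right]; linarith)
    filter_upwards [this] with ε hε hp hq
    simp only [smul_neg, ← sub_eq_add_neg, sub_neg_eq_add] at hε
    rw [hε hq hp, sign_neg h]
    simp
  · filter_upwards [D.eventually_totalWinding_jump_of_pos hsimple h] with ε hε hp hq
    rw [hε hp hq, sign_pos h]
    simp

/-! ### The four sectors at a double point. -/

namespace Chart

variable {D} {i j : Fin D.numComponents} {s t : ℝ} (c : D.Chart i s j t)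

/-- The part of the chart in one of the four quadrants. -/
def quadrant (k : Corner) : Set (ℝ × ℝ) :=
  {z | z ∈ Metric.ball (0 : ℝ × ℝ) c.δ ∧ 0 < ((k.1 : ℤ) : ℝ) * z.1 ∧ 0 < ((k.2 : ℤ) : ℝ) * z.2}

/-- The points of the plane in one of the four corners around a double point. -/
def sector (k : Corner) : Set ℂ := c.φ '' c.quadrant k

theorem apply_mk (z : ℝ × ℝ) :
    c.φ z = D.curve i (s + z.1) + D.curve j (t + z.2) - D.curve i s := c.coe_eq z

theorem isPreconnected_sector (k : Corner) : IsPreconnected (c.sector k) := by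
  have hconv : Convex ℝ (c.quadrant k) := by
    have h1 : Convex ℝ {z : ℝ × ℝ | 0 < ((k.1 : ℤ) : ℝ) * z.1} :=
      convex_halfSpace_gt (f := fun z : ℝ × ℝ => ((k.1 : ℤ) : ℝ) * z.1)
        ⟨fun _ _ => by simp [mul_add], fun _ _ => by simp [mul_left_comm]⟩ 0
    have h2 : Convex ℝ {z : ℝ × ℝ | 0 < ((k.2 : ℤ) : ℝ) * z.2} :=
      convex_halfSpace_gt (f := fun z : ℝ × ℝ => ((k.2 : ℤ) : ℝ) * z.2)
        ⟨fun _ _ => by simp [mul_add], fun _ _ => by simp [mul_left_comm]⟩ 0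
    exact (convex_ball 0 c.δ).inter (h1.inter h2)
  exact hconv.isPreconnected.image _
    (c.φ.continuousOn.mono fun z hz => c.ball_subset hz.1)

theorem sector_subset (k : Corner) : c.sector k ⊆ D.imageᶜ := by
  rintro _ ⟨z, ⟨hz, h1, h2⟩, rfl⟩ himg
  obtain ⟨l, r, hr⟩ := D.mem_image_iff.1 himg
  rcases c.axes z hz l r hr with ⟨h, -⟩ | ⟨h, -⟩
  · simp [h] at h2
  · simp [h] at h1

theorem eventually_mem_sector (h : D.curve i s = D.curve j t) :
    ∀ᶠ z in 𝓝 (D.curve i s), z ∉ D.image → ∃ k, z ∈ c.sector k := by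
  have h0 : (0 : ℝ × ℝ) ∈ Metric.ball (0 : ℝ × ℝ) c.δ := Metric.mem_ball_self c.δ_pos
  have hnhds : c.φ '' Metric.ball 0 c.δ ∈ 𝓝 (c.φ 0) :=
    c.φ.image_mem_nhds (c.ball_subset h0) (Metric.isOpen_ball.mem_nhds h0)
  have hφ0 : c.φ 0 = D.curve i s := by simp [apply_mk, h]
  rw [hφ0] at hnhds
  filter_upwards [hnhds]
  rintro _ ⟨w, hw, rfl⟩ hwi
  have h1 : w.1 ≠ 0 := fun h1 => hwi (D.mem_image_iff.2 ⟨j, t + w.2, by simp [apply_mk, h1]⟩)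
  have h2 : w.2 ≠ 0 := fun h2 => hwi (D.mem_image_iff.2 ⟨i, s + w.1, by simp [apply_mk, h2, h]⟩)
  have key : ∀ r : ℝ, r ≠ 0 → ∃ a : ℤˣ, 0 < ((a : ℤ) : ℝ) * r := fun r hr => by
    rcases hr.lt_or_gt with hr | hr
    · exact ⟨-1, by simpa using hr⟩
    · exact ⟨1, by simpa using hr⟩
  obtain ⟨a, ha⟩ := key _ h1
  obtain ⟨b, hb⟩ := key _ h2
  exact ⟨(a, b), w, ⟨hw, ha, hb⟩, rfl⟩

theorem eventually_pos_mul {f : ℝ → ℝ} {f' a : ℝ} (hf : HasDerivAt f f' 0)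
    (h : 0 < a * f 0 ∨ f 0 = 0 ∧ 0 < a * f') : ∀ᶠ ε in 𝓝[>] (0 : ℝ), 0 < a * f ε := by
  rcases h with h | ⟨h0, h⟩
  · exact ((hf.continuousAt.const_mul a).eventually_const_lt h).filter_mono nhdsWithin_le_nhds
  · have hev := (eventually_sub_mul_neg (hf.const_mul (-a)) (by simp [h0])
      (by linarith)).filter_mono (nhdsGT_le_nhdsNE 0)
    filter_upwards [hev, self_mem_nhdsWithin] with ε h1 (h2 : 0 < ε)
    nlinarith

/-- The ray, pulled back to the chart, leaves `z` with velocity `(a, b)`. Each coordinate either has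
the right sign already or starts at `0` and moves in the right direction. The case of the centre
gives the corners, and points on an axis allow passing from one sector to the next. -/
theorem eventually_add_smul_mem_sector {z : ℝ × ℝ} (hz : z ∈ Metric.ball (0 : ℝ × ℝ) c.δ)
    {k : Corner} {a b : ℝ}
    (h1 : 0 < ((k.1 : ℤ) : ℝ) * z.1 ∨ z.1 = 0 ∧ 0 < ((k.1 : ℤ) : ℝ) * a)
    (h2 : 0 < ((k.2 : ℤ) : ℝ) * z.2 ∨ z.2 = 0 ∧ 0 < ((k.2 : ℤ) : ℝ) * b) :
    ∀ᶠ ε : ℝ in 𝓝[>] 0, c.φ z + ε • (a • deriv (D.curve i) (s + z.1) +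
      b • deriv (D.curve j) (t + z.2)) ∈ c.sector k := by
  have hdet := right_ne_zero_of_mul (c.det_pos z hz).ne'
  set w : ℂ := a • deriv (D.curve i) (s + z.1) + b • deriv (D.curve j) (t + z.2) with hw
  have hder : HasFDerivAt c.φ (planeEquiv _ _ hdet : ℝ × ℝ →L[ℝ] ℂ) z := by
    have : (c.φ : ℝ × ℝ → ℂ) = D.strandMap i s j t := funext c.coe_eq
    rw [this]
    exact D.hasFDerivAt_strandMap i s j t z hdet
  have hzs : z ∈ c.φ.source := c.ball_subset hz
  have hinv : c.φ.symm (c.φ z) = z := c.φ.left_inv hzs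
  have hsymm := c.φ.hasFDerivAt_symm (c.φ.map_source hzs) (by rwa [hinv])
  have hline : HasDerivAt (fun ε : ℝ => c.φ z + ε • w) w 0 := by
    simpa using ((hasDerivAt_id (0 : ℝ)).smul_const w).const_add (c.φ z)
  set γ : ℝ → ℝ × ℝ := fun ε => c.φ.symm (c.φ z + ε • w) with hγ
  have hγ0 : γ 0 = z := by simp [hγ, hinv]
  have hγd : HasDerivAt γ (a, b) 0 := by
    have := HasFDerivAt.comp_hasDerivAt (x := (0 : ℝ)) (f := fun ε : ℝ => c.φ z + ε • w)
      (l := c.φ.symm) (l' := ((planeEquiv _ _ hdet).symm : ℂ →L[ℝ] ℝ × ℝ))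
      (by simpa using hsymm) hline
    have hval : (planeEquiv _ _ hdet).symm w = (a, b) := by
      rw [ContinuousLinearEquiv.symm_apply_eq, planeEquiv_apply]
    rw [ContinuousLinearEquiv.coe_coe, hval] at this
    exact this
  have hγ1 : HasDerivAt (fun ε => (γ ε).1) a 0 :=
    (ContinuousLinearMap.fst ℝ ℝ ℝ).hasFDerivAt.comp_hasDerivAt 0 hγd
  have hγ2 : HasDerivAt (fun ε => (γ ε).2) b 0 :=
    (ContinuousLinearMap.snd ℝ ℝ ℝ).hasFDerivAt.comp_hasDerivAt 0 hγd
  have hball : ∀ᶠ ε in 𝓝[>] (0 : ℝ), γ ε ∈ Metric.ball (0 : ℝ × ℝ) c.δ :=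
    (hγd.continuousAt.eventually (Metric.isOpen_ball.mem_nhds (by rwa [hγ0]))).filter_mono
      nhdsWithin_le_nhds
  have htarget : ∀ᶠ ε in 𝓝[>] (0 : ℝ), c.φ z + ε • w ∈ c.φ.target :=
    (tendsto_add_smul _ w).eventually (c.φ.open_target.mem_nhds (c.φ.map_source hzs))
  filter_upwards [hball, htarget, eventually_pos_mul hγ1 (by rwa [hγ0]),
    eventually_pos_mul hγ2 (by rwa [hγ0])] with ε e1 e2 e3 e4
  exact ⟨γ ε, ⟨e1, e3, e4⟩, c.φ.right_inv e2⟩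

theorem simple_fst (h : D.curve i s = D.curve j t) {r : ℝ} (hr : r ≠ 0) (hrδ : |r| < c.δ)
    (l : Fin D.numComponents) (r' : ℝ) (hl : D.curve l r' = D.curve i (s + r)) :
    D.SamePt l r' i (s + r) := by
  rcases c.axes (r, 0) (mem_ball_zero_prod.2 ⟨hrδ, by simpa using c.δ_pos⟩) l r'
    (by simp [apply_mk, hl, h]) with ⟨-, h'⟩ | ⟨h', -⟩
  · exact h'
  · exact absurd h' hr

theorem simple_snd {r : ℝ} (hr : r ≠ 0) (hrδ : |r| < c.δ)
    (l : Fin D.numComponents) (r' : ℝ) (hl : D.curve l r' = D.curve j (t + r)) :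
    D.SamePt l r' j (t + r) := by
  rcases c.axes (0, r) (mem_ball_zero_prod.2 ⟨by simpa using c.δ_pos, hrδ⟩) l r'
    (by simp [apply_mk, hl]) with ⟨h', -⟩ | ⟨-, h'⟩
  · exact absurd h' hr
  · exact h'

theorem totalWinding_eq_of_mem_sector {k : Corner} {p q : ℂ} (hp : p ∈ c.sector k)
    (hq : q ∈ c.sector k) : D.totalWinding p = D.totalWinding q :=
  (c.isPreconnected_sector k).constant
    (D.continuousOn_totalWinding.mono (c.sector_subset k)) hp hq

theorem unit_mul_self (a : ℤˣ) : ((a : ℤ) : ℝ) * ((a : ℤ) : ℝ) = 1 := by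
  exact_mod_cast Int.units_coe_mul_self a

theorem abs_unit (a : ℤˣ) : |((a : ℤ) : ℝ)| = 1 := by
  rcases Int.units_eq_one_or a with rfl | rfl <;> simp

theorem sign_eq_of_mul_pos {x y : ℝ} (h : 0 < x * y) : SignType.sign x = SignType.sign y := by
  rcases pos_and_pos_or_neg_and_neg_of_mul_pos h with ⟨h1, h2⟩ | ⟨h1, h2⟩
  · rw [sign_pos h1, sign_pos h2]
  · rw [sign_neg h1, sign_neg h2]

/-- The two sectors are neighbours along the first strand. The jump is computed at a simple point
`(r, 0)` of that half-axis, and `det_pos` carries the sign back to the double point. -/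
theorem totalWinding_sub_of_mem_sector_snd (h : D.curve i s = D.curve j t) (a : ℤˣ) {p q : ℂ}
    (hp : p ∈ c.sector (a, 1)) (hq : q ∈ c.sector (a, -1)) :
    D.totalWinding p - D.totalWinding q =
      SignType.sign (planeDet (deriv (D.curve i) s) (deriv (D.curve j) t)) := by
  set r : ℝ := a * (c.δ / 2) with hr
  have hδ := c.δ_pos
  have hrδ : |r| < c.δ := by
    rw [hr, abs_mul, abs_unit, one_mul, abs_of_pos (by positivity)]; linarith
  have hra : 0 < ((a : ℤ) : ℝ) * r := by
    rw [hr, ← mul_assoc, unit_mul_self, one_mul]; positivity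
  have hr0 : r ≠ 0 := right_ne_zero_of_mul hra.ne'
  have hball : (r, (0 : ℝ)) ∈ Metric.ball (0 : ℝ × ℝ) c.δ :=
    mem_ball_zero_prod.2 ⟨hrδ, by simpa using hδ⟩
  have hφ : c.φ (r, 0) = D.curve i (s + r) := by simp [apply_mk, h]
  have hd := c.det_pos _ hball
  simp only [add_zero] at hd
  have e1 := c.eventually_add_smul_mem_sector hball (k := (a, 1)) (a := 0) (b := 1)
    (Or.inl hra) (Or.inr ⟨rfl, by simp⟩)
  have e2 := c.eventually_add_smul_mem_sector hball (k := (a, -1)) (a := 0) (b := -1)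
    (Or.inl hra) (Or.inr ⟨rfl, by simp⟩)
  simp only [hφ, zero_smul, zero_add, one_smul, neg_smul, smul_neg, add_zero] at e1 e2
  simp only [← sub_eq_add_neg] at e2
  have e3 := D.eventually_totalWinding_jump (c.simple_fst h hr0 hrδ)
    (right_ne_zero_of_mul hd.ne')
  obtain ⟨ε, h1, h2, h3⟩ := (e1.and (e2.and e3)).exists
  rw [c.totalWinding_eq_of_mem_sector hp h1, c.totalWinding_eq_of_mem_sector hq h2,
    h3 (c.sector_subset _ h1) (c.sector_subset _ h2), sign_eq_of_mul_pos hd]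

theorem totalWinding_sub_of_mem_sector_fst (b : ℤˣ) {p q : ℂ}
    (hp : p ∈ c.sector (1, b)) (hq : q ∈ c.sector (-1, b)) :
    D.totalWinding p - D.totalWinding q =
      -SignType.sign (planeDet (deriv (D.curve i) s) (deriv (D.curve j) t)) := by
  set r : ℝ := b * (c.δ / 2) with hr
  have hδ := c.δ_pos
  have hrδ : |r| < c.δ := by
    rw [hr, abs_mul, abs_unit, one_mul, abs_of_pos (by positivity)]; linarith
  have hra : 0 < ((b : ℤ) : ℝ) * r := by
    rw [hr, ← mul_assoc, unit_mul_self, one_mul]; positivity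
  have hr0 : r ≠ 0 := right_ne_zero_of_mul hra.ne'
  have hball : ((0 : ℝ), r) ∈ Metric.ball (0 : ℝ × ℝ) c.δ :=
    mem_ball_zero_prod.2 ⟨by simpa using hδ, hrδ⟩
  have hφ : c.φ (0, r) = D.curve j (t + r) := by simp [apply_mk]
  have hd := c.det_pos _ hball
  simp only [add_zero] at hd
  have hd' : planeDet (deriv (D.curve j) (t + r)) (deriv (D.curve i) s) ≠ 0 := by
    rw [planeDet_swap, neg_ne_zero]; exact right_ne_zero_of_mul hd.ne'
  have e1 := c.eventually_add_smul_mem_sector hball (k := (1, b)) (a := 1) (b := 0)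
    (Or.inr ⟨rfl, by simp⟩) (Or.inl hra)
  have e2 := c.eventually_add_smul_mem_sector hball (k := (-1, b)) (a := -1) (b := 0)
    (Or.inr ⟨rfl, by simp⟩) (Or.inl hra)
  simp only [hφ, zero_smul, add_zero, one_smul, neg_smul, smul_neg,
    ← sub_eq_add_neg] at e1 e2
  have e3 := D.eventually_totalWinding_jump (c.simple_snd hr0 hrδ) hd'
  obtain ⟨ε, h1, h2, h3⟩ := (e1.and (e2.and e3)).exists
  rw [c.totalWinding_eq_of_mem_sector hp h1, c.totalWinding_eq_of_mem_sector hq h2,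
    h3 (c.sector_subset _ h1) (c.sector_subset _ h2), planeDet_swap, Left.sign_neg,
    sign_eq_of_mul_pos hd]
  simp

theorem eventually_direction_mem_sector (h : D.curve i s = D.curve j t) (k : Corner) :
    ∀ᶠ ε : ℝ in 𝓝[>] 0, D.curve i s + ε • (((k.1 : ℤ) : ℝ) • deriv (D.curve i) s +
      ((k.2 : ℤ) : ℝ) • deriv (D.curve j) t) ∈ c.sector k := by
  have := c.eventually_add_smul_mem_sector (Metric.mem_ball_self c.δ_pos) (k := k)
    (a := ((k.1 : ℤ) : ℝ)) (b := ((k.2 : ℤ) : ℝ)) (Or.inr ⟨rfl, by rw [unit_mul_self]; simp⟩)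
    (Or.inr ⟨rfl, by rw [unit_mul_self]; simp⟩)
  simpa [apply_mk, h] using this

theorem sector_nonempty (h : D.curve i s = D.curve j t) (k : Corner) : (c.sector k).Nonempty :=
  let ⟨_, hε⟩ := (c.eventually_direction_mem_sector h k).exists
  ⟨_, hε⟩

end Chart

end LinkDiagram

/-! ### Components of the complement of a closed connected set. -/

/-- The closure of a component of the complement of a closed preconnected set `G` together with `G`
is preconnected. -/
theorem isPreconnected_closure_component_union {G : Set ℂ} (hG : IsClosed G)
    (hGc : IsPreconnected G) (hne : G.Nonempty) {p : ℂ} (hp : p ∉ G) :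
    IsPreconnected (closure (connectedComponentIn Gᶜ p) ∪ G) := by
  set V := connectedComponentIn Gᶜ p with hV
  have hVp : IsPreconnected V := isPreconnected_connectedComponentIn
  have hpV : p ∈ V := mem_connectedComponentIn hp
  have hmeet : (closure V ∩ G).Nonempty := by
    by_contra hcon
    rw [not_nonempty_iff_eq_empty] at hcon
    have hcl : closure V ⊆ V := hVp.closure.subset_connectedComponentIn (subset_closure hpV)
      fun z hz hzG => by
        have : z ∈ closure V ∩ G := ⟨hz, hzG⟩
        rw [hcon] at this
        exact this
    -- If the closure of `V` missed `G`, then `V` would be clopen, hence the whole plane, although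
    -- it avoids the nonempty set `G`.
    have hclopen : IsClopen V :=
      ⟨isClosed_of_closure_subset hcl, hG.isOpen_compl.connectedComponentIn⟩
    obtain ⟨g, hg⟩ := hne
    have : g ∈ V := by rw [hclopen.eq_univ ⟨p, hpV⟩]; trivial
    exact connectedComponentIn_subset _ _ this hg
  obtain ⟨z, hz, hz'⟩ := hmeet
  exact hVp.closure.union z hz hz' hGc

theorem closure_component_subset {G : Set ℂ} {p : ℂ} (hp : p ∉ G) :
    closure (connectedComponentIn Gᶜ p) ⊆ connectedComponentIn Gᶜ p ∪ G := fun z hz => by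
  by_cases hzG : z ∈ G
  · exact Or.inr hzG
  · left
    have h : IsPreconnected (insert z (connectedComponentIn Gᶜ p)) :=
      isPreconnected_connectedComponentIn.subset_closure (subset_insert _ _)
        (insert_subset hz subset_closure)
    exact h.subset_connectedComponentIn (mem_insert_of_mem _ (mem_connectedComponentIn hp))
      (insert_subset hzG (connectedComponentIn_subset _ _)) (mem_insert _ _)

/-! ### Crossings, their finiteness, and the cells at their corners. -/

namespace LinkDiagram

variable {D : LinkDiagram}

theorem toParam_coe (p : D.Param) : D.toParam p.1 p.2 = p :=
  Prod.ext rfl (Subtype.ext (Int.fract_eq_self.2 p.2.2))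

namespace Crossing

theorem not_samePt (x : D.Crossing) :
    ¬ D.SamePt x.overPt.1 x.overPt.2 x.underPt.1 x.underPt.2 := by
  rw [← toParam_eq_iff, toParam_coe, toParam_coe]
  intro h
  have := x.height_lt
  rw [h] at this
  exact lt_irrefl _ this

theorem curve_eq (x : D.Crossing) :
    D.curve x.overPt.1 x.overPt.2 = D.curve x.underPt.1 x.underPt.2 := x.pos_eq

theorem ext' {x y : D.Crossing} (h : x.overPt = y.overPt) (h' : x.underPt = y.underPt) :
    x = y := by
  cases x; cases y; cases h; cases h'; rfl

/-- A double point has only two preimages, and their heights decide which is the overpass. -/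
theorem point_injective : Function.Injective (point : D.Crossing → ℂ) := by
  intro x y h
  have hne : ∀ z : D.Crossing, z.overPt ≠ z.underPt := fun z h => by
    have := z.height_lt
    rw [h] at this
    exact lt_irrefl _ this
  have hxu : D.pos x.underPt = x.point := x.pos_eq.symm
  have hyu : D.pos y.underPt = x.point := y.pos_eq.symm.trans h.symm
  have h1 := D.at_most_double y.overPt x.overPt x.underPt h.symm x.pos_eq
  have h2 := D.at_most_double y.underPt x.overPt x.underPt hyu x.pos_eq
  have hx := hne x
  have hy := hne y
  rcases h1 with h1 | h1 | h1
  · rcases h2 with h2 | h2 | h2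
    · exact absurd (h1.trans h2.symm) hy
    · exact absurd h2 hx
    · exact ext' h1.symm h2.symm
  · exact absurd h1 hx
  · rcases h2 with h2 | h2 | h2
    · have e1 := x.height_lt
      have e2 := y.height_lt
      rw [h1, h2] at e2
      exact absurd e1 (lt_asymm e2)
    · exact absurd h2 hx
    · exact absurd (h1.trans h2.symm) hy

theorem point_mem_image (x : D.Crossing) : x.point ∈ D.image := ⟨x.overPt, rfl⟩

end Crossing

theorem exists_injOn_curve (i : Fin D.numComponents) (s : ℝ) :
    ∃ δ > 0, InjOn (D.curve i) (Metric.ball s δ) := by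
  set v := deriv (D.curve i) s with hv
  have hv0 : v ≠ 0 := D.deriv_curve_ne_zero i s
  set g : ℝ → ℝ := fun r => (D.curve i r / v).re with hg
  have hgd : HasStrictDerivAt g 1 s := by
    have h1 : HasStrictDerivAt (D.curve i) v s :=
      (D.contDiff_curve i).contDiffAt.hasStrictDerivAt (by simp)
    have h2 := Complex.reCLM.hasStrictFDerivAt.comp_hasStrictDerivAt s (h1.div_const v)
    rw [div_self hv0] at h2
    exact h2
  set ψ := HasStrictFDerivAt.toOpenPartialHomeomorph g
    (hgd.hasStrictFDerivAt_equiv one_ne_zero)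
  have hsrc : ψ.source ∈ 𝓝 s := ψ.open_source.mem_nhds
    (HasStrictFDerivAt.mem_toOpenPartialHomeomorph_source _)
  obtain ⟨δ, hδ, hball⟩ := Metric.mem_nhds_iff.1 hsrc
  refine ⟨δ, hδ, fun r hr r' hr' h => ψ.injOn (hball hr) (hball hr') ?_⟩
  change g r = g r'
  simp only [hg, h]

/-- Three cases: if the curve points differ, they differ nearby; if the parameters give the same
link point, local injectivity excludes crossings; at a true double point, the chart leaves only that
crossing. Compactness then makes the set of crossings finite. -/
theorem exists_nhds_finite_crossing (i j : Fin D.numComponents) (s t : ℝ) :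
    ∃ A ∈ 𝓝 (s, t), {x : D.Crossing | x.overPt.1 = i ∧ x.underPt.1 = j ∧
      ((x.overPt.2 : ℝ), (x.underPt.2 : ℝ)) ∈ A}.Finite := by
  by_cases hst : D.curve i s = D.curve j t
  swap
  · refine ⟨{z | D.curve i z.1 ≠ D.curve j z.2}, ?_, ?_⟩
    · have h1 := D.continuous_curve i
      have h2 := D.continuous_curve j
      exact (isOpen_ne_fun (by fun_prop) (by fun_prop)).mem_nhds hst
    · convert Set.finite_empty
      ext x
      simp only [mem_ofPred_eq, mem_empty_iff_false, iff_false]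
      rintro ⟨rfl, rfl, h⟩
      exact h x.curve_eq
  by_cases hsame : D.SamePt i s j t
  · obtain ⟨rfl, n, rfl⟩ := hsame
    obtain ⟨δ, hδ, hinj⟩ := D.exists_injOn_curve i (t + n)
    refine ⟨Metric.ball (t + n, t) δ, Metric.ball_mem_nhds _ hδ, ?_⟩
    convert Set.finite_empty
    ext x
    simp only [mem_ofPred_eq, mem_empty_iff_false, iff_false]
    rintro ⟨h1, h2, h⟩
    rw [← ball_prod_same] at h
    refine x.not_samePt ⟨h1.trans h2.symm, n, ?_⟩
    apply hinj h.1
    · have := h.2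
      rw [Metric.mem_ball, Real.dist_eq] at this ⊢
      rwa [add_sub_add_right_eq_sub]
    · rw [curve_add_int, ← h1]
      have := x.curve_eq
      rwa [h2, ← h1] at this
  · obtain ⟨c⟩ := D.nonempty_chart hst hsame
    refine ⟨Metric.ball (s, t) c.δ, Metric.ball_mem_nhds _ c.δ_pos, Set.Subsingleton.finite ?_⟩
    have key : ∀ x : D.Crossing, x.overPt.1 = i → x.underPt.1 = j →
        ((x.overPt.2 : ℝ), (x.underPt.2 : ℝ)) ∈ Metric.ball (s, t) c.δ →
        (x.overPt.2 : ℝ) = s ∧ (x.underPt.2 : ℝ) = t := fun x h1 h2 h => by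
      rw [← ball_prod_same] at h
      have ha : |(x.overPt.2 : ℝ) - s| < c.δ := by simpa [Real.dist_eq] using h.1
      have hb : |(x.underPt.2 : ℝ) - t| < c.δ := by simpa [Real.dist_eq] using h.2
      have hx := x.curve_eq
      rw [h1, h2] at hx
      have hza : ((x.overPt.2 : ℝ) - s, (0 : ℝ)) ∈ Metric.ball (0 : ℝ × ℝ) c.δ :=
        mem_ball_zero_prod.2 ⟨ha, by simpa using c.δ_pos⟩
      have hzb : ((0 : ℝ), (x.underPt.2 : ℝ) - t) ∈ Metric.ball (0 : ℝ × ℝ) c.δ :=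
        mem_ball_zero_prod.2 ⟨by simpa using c.δ_pos, hb⟩
      have := c.φ.injOn (c.ball_subset hza) (c.ball_subset hzb) (by simp [Chart.apply_mk, hx, hst])
      rw [Prod.mk.injEq] at this
      exact ⟨by linarith [this.1], by linarith [this.2]⟩
    rintro x ⟨h1, h2, h⟩ y ⟨h1', h2', h'⟩
    obtain ⟨e1, e2⟩ := key x h1 h2 h
    obtain ⟨e1', e2'⟩ := key y h1' h2' h'
    exact Crossing.ext' (Prod.ext (h1.trans h1'.symm) (Subtype.ext (e1.trans e1'.symm)))
      (Prod.ext (h2.trans h2'.symm) (Subtype.ext (e2.trans e2'.symm)))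

instance finite_crossing : Finite D.Crossing := by
  have key : ∀ i j : Fin D.numComponents, {x : D.Crossing | x.overPt.1 = i ∧ x.underPt.1 = j ∧
      ((x.overPt.2 : ℝ), (x.underPt.2 : ℝ)) ∈ Icc (0 : ℝ) 1 ×ˢ Icc (0 : ℝ) 1}.Finite :=
    fun i j => by
      refine (isCompact_Icc.prod isCompact_Icc).induction_on
        (p := fun A => {x : D.Crossing | x.overPt.1 = i ∧ x.underPt.1 = j ∧
          ((x.overPt.2 : ℝ), (x.underPt.2 : ℝ)) ∈ A}.Finite) ?_ ?_ ?_ ?_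
      · simp
      · exact fun A B hAB hB => hB.subset fun x hx => ⟨hx.1, hx.2.1, hAB hx.2.2⟩
      · refine fun A B hA hB => (hA.union hB).subset fun x hx => ?_
        rcases hx.2.2 with h | h
        · exact Or.inl ⟨hx.1, hx.2.1, h⟩
        · exact Or.inr ⟨hx.1, hx.2.1, h⟩
      · rintro ⟨s, t⟩ -
        obtain ⟨A, hA, hfin⟩ := exists_nhds_finite_crossing (D := D) i j s t
        exact ⟨A, mem_nhdsWithin_of_mem_nhds hA, hfin⟩
  have huniv : (univ : Set D.Crossing) = ⋃ i, ⋃ j, {x : D.Crossing | x.overPt.1 = i ∧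
      x.underPt.1 = j ∧ ((x.overPt.2 : ℝ), (x.underPt.2 : ℝ)) ∈ Icc (0 : ℝ) 1 ×ˢ Icc (0 : ℝ) 1} := by
    ext x
    simp only [mem_univ, mem_iUnion, true_iff]
    exact ⟨_, _, rfl, rfl, Ico_subset_Icc_self x.overPt.2.2, Ico_subset_Icc_self x.underPt.2.2⟩
  rw [← Set.finite_univ_iff, huniv]
  exact Set.finite_iUnion fun i => Set.finite_iUnion fun j => key i j

namespace Crossing

/-- A chart around a crossing. -/
noncomputable def chart (x : D.Crossing) :
    D.Chart x.overPt.1 x.overPt.2 x.underPt.1 x.underPt.2 :=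
  Classical.choice (D.nonempty_chart x.curve_eq x.not_samePt)

/-- The points near a crossing in one of its corners. -/
noncomputable def sector (x : D.Crossing) (k : Corner) : Set ℂ := x.chart.sector k

theorem isPreconnected_sector (x : D.Crossing) (k : Corner) : IsPreconnected (x.sector k) :=
  x.chart.isPreconnected_sector k

theorem sector_subset (x : D.Crossing) (k : Corner) : x.sector k ⊆ D.imageᶜ :=
  x.chart.sector_subset k

theorem eventually_mem_sector (x : D.Crossing) :
    ∀ᶠ z in 𝓝 x.point, z ∉ D.image → ∃ k, z ∈ x.sector k :=
  x.chart.eventually_mem_sector x.curve_eq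

theorem eventually_direction_mem_sector (x : D.Crossing) (k : Corner) :
    ∀ᶠ ε : ℝ in 𝓝[>] 0, x.point + ε • x.direction k ∈ x.sector k :=
  x.chart.eventually_direction_mem_sector x.curve_eq k

/-- A point in one of the corners of a crossing. -/
noncomputable def cornerPt (x : D.Crossing) (k : Corner) : ℂ :=
  (x.chart.sector_nonempty x.curve_eq k).choose

theorem cornerPt_mem (x : D.Crossing) (k : Corner) : x.cornerPt k ∈ x.sector k :=
  (x.chart.sector_nonempty x.curve_eq k).choose_spec

theorem cornerPt_notMem_image (x : D.Crossing) (k : Corner) : x.cornerPt k ∉ D.image :=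
  x.sector_subset k (x.cornerPt_mem k)

/-- The plane region at a corner of a crossing. -/
noncomputable def cell (x : D.Crossing) (k : Corner) : Set ℂ :=
  connectedComponentIn D.imageᶜ (x.cornerPt k)

theorem isPreconnected_cell (x : D.Crossing) (k : Corner) : IsPreconnected (x.cell k) :=
  isPreconnected_connectedComponentIn

theorem cell_subset (x : D.Crossing) (k : Corner) : x.cell k ⊆ D.imageᶜ :=
  connectedComponentIn_subset _ _

theorem sector_subset_cell (x : D.Crossing) (k : Corner) : x.sector k ⊆ x.cell k :=
  (x.isPreconnected_sector k).subset_connectedComponentIn (x.cornerPt_mem k) (x.sector_subset k)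

theorem cornerPt_mem_cell (x : D.Crossing) (k : Corner) : x.cornerPt k ∈ x.cell k :=
  x.sector_subset_cell k (x.cornerPt_mem k)

theorem isOpen_cell (x : D.Crossing) (k : Corner) : IsOpen (x.cell k) :=
  D.isCompact_image.isClosed.isOpen_compl.connectedComponentIn

theorem cell_eq_of_mem {x y : D.Crossing} {k l : Corner} {z : ℂ} (hx : z ∈ x.cell k)
    (hy : z ∈ y.cell l) : x.cell k = y.cell l :=
  (connectedComponentIn_eq hx).trans (connectedComponentIn_eq hy).symm

theorem point_mem_closure_cell (x : D.Crossing) (k : Corner) : x.point ∈ closure (x.cell k) :=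
  mem_closure_of_tendsto (tendsto_add_smul x.point (x.direction k))
    ((x.eventually_direction_mem_sector k).mono fun _ h => x.sector_subset_cell k h)

theorem isPreconnected_insert_cell (x : D.Crossing) (k : Corner) :
    IsPreconnected (insert x.point (x.cell k)) :=
  (x.isPreconnected_cell k).subset_closure (subset_insert _ _)
    (insert_subset (x.point_mem_closure_cell k) subset_closure)

/-- The total winding number at a corner of a crossing. -/
noncomputable def cornerWinding (x : D.Crossing) (k : Corner) : ℤ :=
  D.totalWinding (x.cornerPt k)

theorem cornerWinding_eq {x y : D.Crossing} {k l : Corner} (h : x.cell k = y.cell l) :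
    x.cornerWinding k = y.cornerWinding l :=
  (x.isPreconnected_cell k).constant (D.continuousOn_totalWinding.mono (x.cell_subset k))
    (x.cornerPt_mem_cell k) (h ▸ y.cornerPt_mem_cell l)

theorem planeDet_vel_ne_zero (x : D.Crossing) :
    planeDet (D.vel x.overPt) (D.vel x.underPt) ≠ 0 :=
  D.planeDet_deriv_ne_zero x.curve_eq x.not_samePt

open Classical in
/-- The sign of a crossing: `1` if the underpass crosses the overpass from its right to its left
and `-1` otherwise. -/
noncomputable def sign (x : D.Crossing) : ℤˣ :=
  if 0 < planeDet (D.vel x.overPt) (D.vel x.underPt) then 1 else -1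

theorem coe_sign (x : D.Crossing) :
    ((x.sign : ℤˣ) : ℤ) = SignType.sign (planeDet (D.vel x.overPt) (D.vel x.underPt)) := by
  rw [sign]
  split_ifs with h
  · rw [sign_pos h]; rfl
  · rw [sign_neg (lt_of_le_of_ne (not_lt.1 h) x.planeDet_vel_ne_zero)]; rfl

theorem cornerWinding_sub_snd (x : D.Crossing) (a : ℤˣ) :
    x.cornerWinding (a, 1) - x.cornerWinding (a, -1) = x.sign := by
  rw [coe_sign]
  exact x.chart.totalWinding_sub_of_mem_sector_snd x.curve_eq a (x.cornerPt_mem _)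
    (x.cornerPt_mem _)

theorem cornerWinding_sub_fst (x : D.Crossing) (b : ℤˣ) :
    x.cornerWinding (1, b) - x.cornerWinding (-1, b) = -x.sign := by
  rw [coe_sign]
  exact x.chart.totalWinding_sub_of_mem_sector_fst b (x.cornerPt_mem _) (x.cornerPt_mem _)

theorem isPositiveCorner_iff (x : D.Crossing) (k : Corner) :
    x.IsPositiveCorner k ↔ k.1 * k.2 = -x.sign := by
  rw [IsPositiveCorner, planeDet_smul_smul, planeDet_swap]
  have h0 := x.planeDet_vel_ne_zero
  obtain ⟨a, b⟩ := k
  rw [sign]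
  rcases Int.units_eq_one_or a with rfl | rfl <;> rcases Int.units_eq_one_or b with rfl | rfl <;>
    split_ifs with h <;> simp <;> first | linarith | exact lt_of_le_of_ne (not_lt.1 h) h0

end Crossing

end LinkDiagram

/-! ### Loops that separate opposite corners. -/

/-- A connected open set `R` which reaches a point `x` from two opposite directions contains, up to
`x`, a loop through `x` which separates the two sides of `x`. -/
theorem exists_separating_loop {x d : ℂ} {R : Set ℂ} (hR : IsOpen R) (hRc : IsConnected R)
    (hx : x ∉ R) (hd : d ≠ 0) (h1 : ∀ᶠ ε : ℝ in 𝓝[>] 0, x + ε • d ∈ R)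
    (h2 : ∀ᶠ ε : ℝ in 𝓝[>] 0, x - ε • d ∈ R) :
    ∃ G : Set ℂ, IsClosed G ∧ IsPreconnected G ∧ x ∈ G ∧ G ⊆ insert x R ∧
      ∃ w : ℂ → ℤ, ContinuousOn w Gᶜ ∧ ∀ u, planeDet d u ≠ 0 →
        ∀ᶠ ε : ℝ in 𝓝[>] 0, x + ε • u ∉ G → x - ε • u ∉ G → w (x + ε • u) ≠ w (x - ε • u) := by
  obtain ⟨e, he, hball⟩ := mem_nhdsGT_iff_exists_Ioc_subset.1 (h1.and h2)
  have he : 0 < e := he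
  obtain ⟨P, hP⟩ := (hR.isConnected_iff_isPathConnected.1 hRc).joinedIn _
    (hball ⟨he, le_rfl⟩).1 _ (hball ⟨he, le_rfl⟩).2
  have hPext : ∀ t, P.extend t ∈ R := fun t => hP _
  -- A straight segment through `x` for `|t| ≤ e`, closed up by a path in `R` on `[e, e + 1]` and
  -- constant outside `[-e, e + 1]`. The loop may cross itself within `R`; only simplicity at `x`
  -- matters.
  set ℓ : ℝ → ℂ := fun t => if t ≤ e then x + (max t (-e)) • d else P.extend (t - e) with hℓ
  have hcont : Continuous ℓ := by
    refine Continuous.if_le (by fun_prop) (P.continuous_extend.comp (by fun_prop)) continuous_id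
      continuous_const fun t ht => ?_
    rw [ht, sub_self, Path.extend_zero, max_eq_left (by linarith)]
  have hle : ∀ t, t ≤ e → ℓ t = x + (max t (-e)) • d := fun t ht => if_pos ht
  have hgt : ∀ t, e < t → ℓ t = P.extend (t - e) := fun t ht => if_neg (not_le.2 ht)
  have hends : ℓ (-e) = ℓ (e + 1) := by
    rw [hle _ (by linarith), hgt _ (by linarith), max_self, add_sub_cancel_left, Path.extend_one,
      neg_smul, sub_eq_add_neg]
  have hrange : range ℓ = ℓ '' Icc (-e) (e + 1) := by
    refine Subset.antisymm ?_ (image_subset_range _ _)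
    rintro _ ⟨t, rfl⟩
    rcases lt_or_ge t (-e) with ht | ht
    · refine ⟨-e, ⟨le_rfl, by linarith⟩, ?_⟩
      rw [hle _ (by linarith), hle _ (by linarith), max_self, max_eq_right ht.le]
    · rcases lt_or_ge (e + 1) t with ht' | ht'
      · refine ⟨e + 1, ⟨by linarith, le_rfl⟩, ?_⟩
        rw [hgt _ (by linarith), hgt _ (by linarith), add_sub_cancel_left, Path.extend_one,
          Path.extend_of_one_le _ (by linarith)]
      · exact ⟨t, ⟨ht, ht'⟩, rfl⟩
  have hclosed : IsClosed (range ℓ) := by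
    rw [hrange]; exact (isCompact_Icc.image hcont).isClosed
  have hmem : ∀ t, ℓ t ∈ insert x R := fun t => by
    rcases le_or_gt t e with ht | ht
    · rw [hle t ht]
      have h3 : max t (-e) ≤ e := max_le ht (by linarith)
      rcases lt_trichotomy (max t (-e)) 0 with h0 | h0 | h0
      · right
        have h4 : -max t (-e) ∈ Ioc 0 e :=
          ⟨by linarith, by linarith [le_max_right t (-e)]⟩
        have := (hball h4).2
        rwa [neg_smul, sub_neg_eq_add] at this
      · left; rw [h0]; simp
      · exact Or.inr (hball ⟨h0, h3⟩).1
    · rw [hgt t ht]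
      exact Or.inr (hPext _)
  have hzero : ℓ 0 = x := by
    rw [hle 0 he.le, max_eq_left (by linarith), zero_smul, add_zero]
  have hsimple : ∀ t ∈ Icc (-e) (e + 1), ℓ t = ℓ 0 → t = 0 := fun t ht h => by
    rw [hzero] at h
    rcases le_or_gt t e with hte | hte
    · rw [hle t hte, max_eq_left ht.1] at h
      have : t • d = 0 := by linear_combination h
      exact (smul_eq_zero.1 this).resolve_right hd
    · rw [hgt t hte] at h
      exact absurd (h ▸ hPext _) hx
  have hderiv : HasDerivAt ℓ d 0 := by
    have h3 : HasDerivAt (fun t : ℝ => x + t • d) d 0 := by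
      simpa using ((hasDerivAt_id (0 : ℝ)).smul_const d).const_add x
    refine h3.congr_of_eventuallyEq ?_
    filter_upwards [Ioo_mem_nhds (show -e < 0 by linarith) he] with t ht
    rw [hle t ht.2.le, max_eq_left ht.1.le]
  refine ⟨range ℓ, hclosed, isPreconnected_range hcont, ⟨0, hzero⟩,
    range_subset_iff.2 hmem, winding ℓ (-e) (e + 1),
    continuousOn_winding hcont hclosed (by linarith) hends, fun u hu => ?_⟩
  rcases hu.lt_or_gt with hu | hu
  · have := eventually_winding_jump hcont hends (τ := 0) (by linarith) (by linarith) hsimple hderiv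
      (u := -u) (by rw [planeDet_neg_right]; linarith)
    rw [hzero] at this
    filter_upwards [this] with ε hε hp hq heq
    simp only [smul_neg, ← sub_eq_add_neg, sub_neg_eq_add] at hε
    have := hε hq hp
    omega
  · have := eventually_winding_jump hcont hends (τ := 0) (by linarith) (by linarith) hsimple hderiv
      hu
    rw [hzero] at this
    filter_upwards [this] with ε hε hp hq heq
    have := hε hp hq
    omega

/-! ### Winding numbers at corners, cuts at reducible crossings, and their nesting. -/

namespace LinkDiagram

variable {D : LinkDiagram}

theorem corner_eq_or (k l : Corner) :
    l = k ∨ l = -k ∨ l = (k.1, -k.2) ∨ l = (-k.1, k.2) := by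
  obtain ⟨a, b⟩ := k
  obtain ⟨c, d⟩ := l
  rcases Int.units_eq_one_or a with rfl | rfl <;> rcases Int.units_eq_one_or b with rfl | rfl <;>
  rcases Int.units_eq_one_or c with rfl | rfl <;> rcases Int.units_eq_one_or d with rfl | rfl <;>
  decide

namespace Crossing

/-- With value `a` at `(1, 1)`, the winding number is `a` at `(-1, -1)` too, and `a - sign`, `a +
sign` at `(1, -1)`, `(-1, 1)`. So adjacent corners differ by one, and the latter opposite pair,
differing by two, can never lie in one region. Doubling avoids fractions. -/
theorem cornerWinding_formula (x : D.Crossing) (k : Corner) :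
    2 * x.cornerWinding k = 2 * x.cornerWinding (1, 1) +
      x.sign * (((k.2 : ℤˣ) : ℤ) - ((k.1 : ℤˣ) : ℤ)) := by
  have h1 := x.cornerWinding_sub_snd 1
  have h2 := x.cornerWinding_sub_snd (-1)
  have h3 := x.cornerWinding_sub_fst 1
  obtain ⟨a, b⟩ := k
  rcases Int.units_eq_one_or a with rfl | rfl <;> rcases Int.units_eq_one_or b with rfl | rfl <;>
    push_cast <;> linarith

/-- Regions at adjacent corners are distinct. -/
theorem mul_eq_mul_of_cell_eq (x : D.Crossing) {k l : Corner} (h : x.cell k = x.cell l) :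
    k.1 * k.2 = l.1 * l.2 := by
  have h1 := x.cornerWinding_formula k
  have h2 := x.cornerWinding_formula l
  rw [cornerWinding_eq h] at h1
  have hs := Int.units_eq_one_or x.sign
  obtain ⟨a, b⟩ := k
  obtain ⟨c, d⟩ := l
  rcases Int.units_eq_one_or a with rfl | rfl <;> rcases Int.units_eq_one_or b with rfl | rfl <;>
  rcases Int.units_eq_one_or c with rfl | rfl <;> rcases Int.units_eq_one_or d with rfl | rfl <;>
  rcases hs with hs | hs <;> first | rfl | (rw [hs] at h1 h2; push_cast at h1 h2; omega)

/-- At most one pair of opposite corners belongs to a single region. -/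
theorem mul_eq_mul_of_cell_neg_eq (x : D.Crossing) {k l : Corner} (hk : x.cell k = x.cell (-k))
    (hl : x.cell l = x.cell (-l)) : k.1 * k.2 = l.1 * l.2 := by
  have h1 := x.cornerWinding_formula k
  have h2 := x.cornerWinding_formula (-k)
  have h3 := x.cornerWinding_formula l
  have h4 := x.cornerWinding_formula (-l)
  rw [cornerWinding_eq hk] at h1
  rw [cornerWinding_eq hl] at h3
  have hs := Int.units_eq_one_or x.sign
  obtain ⟨a, b⟩ := k
  obtain ⟨c, d⟩ := l
  simp only [Prod.neg_mk] at h1 h2 h3 h4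
  rcases Int.units_eq_one_or a with rfl | rfl <;> rcases Int.units_eq_one_or b with rfl | rfl <;>
  rcases Int.units_eq_one_or c with rfl | rfl <;> rcases Int.units_eq_one_or d with rfl | rfl <;>
  rcases hs with hs | hs <;>
    first | rfl | (rw [hs] at h1 h2 h3 h4; push_cast at h1 h2 h3 h4; omega)

theorem direction_neg (x : D.Crossing) (k : Corner) : x.direction (-k) = -x.direction k := by
  simp only [direction, Prod.fst_neg, Prod.snd_neg, Units.val_neg, Int.cast_neg, neg_smul]
  ring

theorem planeDet_direction (x : D.Crossing) (k : Corner) :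
    planeDet (x.direction k) (x.direction (k.1, -k.2)) =
      -2 * (((k.1 : ℤ) : ℝ) * ((k.2 : ℤ) : ℝ)) * planeDet (D.vel x.overPt) (D.vel x.underPt) := by
  simp only [direction, Units.val_neg, Int.cast_neg, planeDet, Complex.add_re, Complex.add_im,
    Complex.real_smul, Complex.mul_re, Complex.mul_im, Complex.ofReal_re, Complex.ofReal_im,
    Complex.neg_re, Complex.neg_im, Complex.ofReal_neg]
  ring

theorem planeDet_direction_ne_zero (x : D.Crossing) (k : Corner) :
    planeDet (x.direction k) (x.direction (k.1, -k.2)) ≠ 0 := by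
  rw [planeDet_direction]
  have hu : ∀ a : ℤˣ, ((a : ℤ) : ℝ) ≠ 0 := fun a => by exact_mod_cast a.ne_zero
  have := x.planeDet_vel_ne_zero
  have h1 := hu k.1
  have h2 := hu k.2
  simp [*]

theorem point_ne_of_mem_cell {x y : D.Crossing} {k : Corner} {z : ℂ} (hz : z ∈ y.cell k) :
    z ≠ x.point := fun h => y.cell_subset k hz (h ▸ x.point_mem_image)

/-- A point of the image that is not a double point. -/
theorem exists_mem_image_ne_point (x : D.Crossing) :
    ∃ b ∈ D.image, ∀ y : D.Crossing, y.point ≠ b := by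
  have hδ := x.chart.δ_pos
  have hhalf : |x.chart.δ / 2| < x.chart.δ := by rw [abs_of_pos (by positivity)]; linarith
  refine ⟨D.curve x.overPt.1 (x.overPt.2 + x.chart.δ / 2), D.mem_image_iff.2 ⟨_, _, rfl⟩,
    fun y hy => ?_⟩
  have h1 := x.chart.simple_fst x.curve_eq (by positivity) hhalf y.overPt.1 y.overPt.2 hy
  have h2 := x.chart.simple_fst x.curve_eq (by positivity) hhalf y.underPt.1 y.underPt.2
    (y.curve_eq.symm.trans hy)
  exact y.not_samePt (h1.trans h2.symm)

/-- A loop through the crossing `x` in the region `R` touching it at two opposite corners, with a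
locally constant function `w` on its complement and the value `c` of `w` on one of its sides, which
is not the side of the base point `b`. -/
structure Cut (x : D.Crossing) (b : ℂ) where
  /-- the region that contains the loop -/
  R : Set ℂ
  /-- the loop -/
  G : Set ℂ
  /-- the locally constant function -/
  w : ℂ → ℤ
  /-- the value on the inner side -/
  c : ℤ
  isClosed : IsClosed G
  isPreconnected : IsPreconnected G
  point_mem : x.point ∈ G
  subset : G ⊆ insert x.point R
  continuousOn : ContinuousOn w Gᶜ
  base : w b ≠ c
  cell_eq : ∀ k, x.cell k = x.cell (-k) → x.cell k = R
  exists_cell : ∃ k, x.cell k = x.cell (-k)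
  side : ∀ k, x.cell k = x.cell (-k) →
    (w (x.cornerPt (k.1, -k.2)) = c ↔ ¬ w (x.cornerPt (-k.1, k.2)) = c)

/-- The separating loop is taken in the cell of `k`. The two adjacent cells are different from it,
so they miss the loop and have constant `w`, with distinct values because of the jump across `x`. -/
theorem nonempty_cut (x : D.Crossing) (b : ℂ) {k : Corner} (hk : x.cell k = x.cell (-k)) :
    Nonempty (x.Cut b) := by
  have hR : ∀ᶠ ε : ℝ in 𝓝[>] 0, x.point - ε • x.direction k ∈ x.cell k := by
    filter_upwards [x.eventually_direction_mem_sector (-k)] with ε hε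
    rw [direction_neg, smul_neg, ← sub_eq_add_neg] at hε
    exact hk ▸ x.sector_subset_cell _ hε
  have hd := x.planeDet_direction_ne_zero k
  obtain ⟨G, hcl, hpre, hmem, hsub, w, hw, hjump⟩ := exists_separating_loop (x.isOpen_cell k)
    ⟨⟨_, x.cornerPt_mem_cell k⟩, x.isPreconnected_cell k⟩
    (fun h => x.cell_subset k h x.point_mem_image)
    (fun h0 => by rw [h0] at hd; simp [planeDet] at hd)
    ((x.eventually_direction_mem_sector k).mono fun _ h => x.sector_subset_cell k h) hR
  have hdisj : ∀ l : Corner, l.1 * l.2 = -(k.1 * k.2) → x.cell l ⊆ Gᶜ := fun l hl z hz hzG => by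
    rcases hsub hzG with h | h
    · exact point_ne_of_mem_cell hz h
    · have := x.mul_eq_mul_of_cell_eq (cell_eq_of_mem hz h)
      rw [hl] at this
      exact units_ne_neg_self _ this.symm
  have h1 := hdisj (k.1, -k.2) (by simp)
  have h2 := hdisj (-k.1, k.2) (by simp)
  have hne : w (x.cornerPt (k.1, -k.2)) ≠ w (x.cornerPt (-k.1, k.2)) := by
    have e1 := x.eventually_direction_mem_sector (k.1, -k.2)
    have e2 := x.eventually_direction_mem_sector (-(k.1, -k.2))
    simp only [direction_neg, smul_neg, ← sub_eq_add_neg] at e2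
    simp only [Prod.neg_mk, neg_neg] at e2
    obtain ⟨ε, ⟨e1, e2⟩, e3⟩ := ((e1.and e2).and (hjump _ hd)).exists
    have e1' := x.sector_subset_cell _ e1
    have e2' := x.sector_subset_cell _ e2
    rw [(x.isPreconnected_cell _).constant (hw.mono h1) (x.cornerPt_mem_cell _) e1',
      (x.isPreconnected_cell _).constant (hw.mono h2) (x.cornerPt_mem_cell _) e2']
    exact e3 (h1 e1') (h2 e2')
  -- Of the two distinct values beside `x`, at least one is not taken at `b`; it marks the inner
  -- side.
  obtain ⟨c, hc, hside⟩ : ∃ c, w b ≠ c ∧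
      (w (x.cornerPt (k.1, -k.2)) = c ↔ ¬ w (x.cornerPt (-k.1, k.2)) = c) := by
    by_cases hb : w b = w (x.cornerPt (k.1, -k.2))
    · exact ⟨w (x.cornerPt (-k.1, k.2)), fun h => hne (hb.symm.trans h),
        by simp only [not_true_eq_false, iff_false]; exact hne⟩
    · exact ⟨w (x.cornerPt (k.1, -k.2)), hb, by simpa using hne.symm⟩
  have huniq : ∀ l, x.cell l = x.cell (-l) → l = k ∨ l = -k := fun l hl => by
    have := x.mul_eq_mul_of_cell_neg_eq hk hl
    rcases corner_eq_or k l with h | h | h | h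
    · exact Or.inl h
    · exact Or.inr h
    · rw [h] at this; simp only [mul_neg] at this; exact absurd this (units_ne_neg_self _)
    · rw [h] at this; simp only [neg_mul] at this; exact absurd this (units_ne_neg_self _)
  refine ⟨⟨x.cell k, G, w, c, hcl, hpre, hmem, hsub, hw, hc, fun l hl => ?_, ⟨k, hk⟩,
    fun l hl => ?_⟩⟩
  · rcases huniq l hl with rfl | rfl
    · rfl
    · exact hk.symm
  · rcases huniq l hl with rfl | rfl
    · exact hside
    · simp only [Prod.fst_neg, Prod.snd_neg, neg_neg]
      tauto

namespace Cut

variable {x y : D.Crossing} {b : ℂ}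

theorem disjoint_image (g : x.Cut b) {z : ℂ} (hz : z ∈ D.image) (hne : z ≠ x.point) :
    z ∉ g.G := fun h => by
  obtain ⟨k, hk⟩ := g.exists_cell
  rcases g.subset h with h | h
  · exact hne h
  · rw [← g.cell_eq k hk] at h
    exact x.cell_subset k h hz

theorem disjoint_cell (g : x.Cut b) {l : Corner} (h : y.cell l ≠ g.R) : y.cell l ⊆ g.Gᶜ :=
  fun z hz hzG => by
    obtain ⟨k, hk⟩ := g.exists_cell
    rw [← g.cell_eq k hk] at h
    rcases g.subset hzG with h' | h'
    · exact point_ne_of_mem_cell hz h'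
    · rw [← g.cell_eq k hk] at h'
      exact h (cell_eq_of_mem hz h')

theorem insert_subset_compl (g : x.Cut b) (hxy : y ≠ x) {l : Corner} (h : y.cell l ≠ g.R) :
    insert y.point (y.cell l) ⊆ g.Gᶜ :=
  insert_subset (g.disjoint_image y.point_mem_image fun h => hxy (point_injective h))
    (g.disjoint_cell h)

theorem w_eq (g : x.Cut b) (hxy : y ≠ x) {l : Corner} (h : y.cell l ≠ g.R) {z : ℂ}
    (hz : z ∈ insert y.point (y.cell l)) : g.w z = g.w y.point :=
  (y.isPreconnected_insert_cell l).constant (g.continuousOn.mono (g.insert_subset_compl hxy h))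
    hz (mem_insert _ _)

/-- If the loop at `y` is on the inner side of the loop at `x`, then all points that are not on the
inner side of `x` are on the same side of `y`. -/
theorem w_eq_of_outside (g : x.Cut b) (g' : y.Cut b) (hxy : y ≠ x) (hR : g'.R ≠ g.R)
    (hin : g.w y.point = g.c) {p : ℂ} (hp : p ∉ g.G) (hpc : g.w p ≠ g.c) :
    g'.w p = g'.w x.point := by
  obtain ⟨l, hl⟩ := g'.exists_cell
  have hcell := g'.cell_eq l hl
  have hGin : ∀ z ∈ g'.G, z ∉ g.G ∧ g.w z = g.c := fun z hz => by
    have hz' := g'.subset hz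
    rw [← hcell] at hz' hR
    exact ⟨g.insert_subset_compl hxy hR hz', (g.w_eq hxy hR hz').trans hin⟩
  -- The loop of `y` stays where `g.w` equals `g.c`, while the component of `p` has another value.
  -- Hence that component, its closure and `g.G` all avoid the loop of `y`; together they form a
  -- connected set joining `p` to `x.point`.
  have hsub : closure (connectedComponentIn g.Gᶜ p) ∪ g.G ⊆ g'.Gᶜ := by
    rintro z hz hzG
    obtain ⟨h1, h2⟩ := hGin z hzG
    have hz' : z ∈ connectedComponentIn g.Gᶜ p := by
      rcases hz with hz | hz
      · exact (closure_component_subset hp hz).resolve_right h1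
      · exact absurd hz h1
    have := isPreconnected_connectedComponentIn.constant
      (g.continuousOn.mono (connectedComponentIn_subset _ _)) hz' (mem_connectedComponentIn hp)
    exact hpc (this.symm.trans h2)
  exact (isPreconnected_closure_component_union g.isClosed g.isPreconnected ⟨_, g.point_mem⟩
    hp).constant (g'.continuousOn.mono hsub)
    (Or.inl (subset_closure (mem_connectedComponentIn hp))) (Or.inr g.point_mem)

/-- The crossings on the inner side of the loop. -/
def inner (g : x.Cut b) : Set D.Crossing := {y | y ≠ x ∧ g.w y.point = g.c}

/-- The base point `b` is outside both loops. As everything outside the loop of `x` lies on one side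
of the loop of `y`, that side is outer for `y`. So the inner crossings of `y` are inner for `x`, and
`y` itself is lost. -/
theorem ncard_inner_lt (g : x.Cut b) (g' : y.Cut b) (hb : b ∈ D.image)
    (hbp : ∀ z : D.Crossing, z.point ≠ b) (hxy : y ≠ x) (hR : g'.R ≠ g.R)
    (hin : g.w y.point = g.c) : g'.inner.ncard < g.inner.ncard := by
  refine Set.ncard_lt_ncard ?_ (Set.toFinite _)
  have hx : g'.w x.point ≠ g'.c := by
    rw [← w_eq_of_outside g g' hxy hR hin (g.disjoint_image hb (hbp x).symm) g.base]
    exact g'.base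
  refine (ssubset_iff_of_subset fun z hz => ?_).2 ⟨y, ⟨hxy, hin⟩, fun h => h.1 rfl⟩
  have hzx : z ≠ x := by
    rintro rfl
    exact hx hz.2
  refine ⟨hzx, ?_⟩
  by_contra hzc
  refine hx ?_
  rw [← w_eq_of_outside g g' hxy hR hin (g.disjoint_image z.point_mem_image
    fun h => hzx (point_injective h)) hzc]
  exact hz.2

end Cut

end Crossing

/-- Every crossing touched by a region at two opposite corners divides the other regions into inner
and outer ones, compatibly with the other crossings. -/
theorem exists_inside (D : LinkDiagram) :
    ∃ (S : D.Crossing → D.Crossing → Corner → Prop) (N : D.Crossing → ℕ),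
      (∀ x y l z m, y.cell l = z.cell m → (S x y l ↔ S x z m)) ∧
      ∀ x k, x.cell k = x.cell (-k) →
        (∀ y, y ≠ x → ∀ l l', y.cell l ≠ x.cell k → y.cell l' ≠ x.cell k →
          (S x y l ↔ S x y l')) ∧
        (S x x (k.1, -k.2) ↔ ¬ S x x (-k.1, k.2)) ∧
        ∀ y l, y.cell l = y.cell (-l) → y.cell l ≠ x.cell k → S x y l → N y < N x := by
  classical
  rcases isEmpty_or_nonempty D.Crossing with hE | ⟨⟨x₀⟩⟩
  · exact ⟨fun _ _ _ => False, fun _ => 0, fun x => isEmptyElim x, fun x => isEmptyElim x⟩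
  obtain ⟨b, hb, hbp⟩ := x₀.exists_mem_image_ne_point
  have hcut : ∀ x : D.Crossing, (∃ k, x.cell k = x.cell (-k)) → Nonempty (x.Cut b) :=
    fun x ⟨k, hk⟩ => x.nonempty_cut b hk
  let g : ∀ x : D.Crossing, (∃ k, x.cell k = x.cell (-k)) → x.Cut b :=
    fun x h => Classical.choice (hcut x h)
  -- `S x y l` says that the cell of `y` at `l` is not `R` and lies on the inner side of the cut at
  -- `x`. Without a cut, `S` is false and `N` takes the irrelevant value `0`.
  refine ⟨fun x y l => ∃ h, y.cell l ≠ (g x h).R ∧ (g x h).w (y.cornerPt l) = (g x h).c,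
    fun x => if h : ∃ k, x.cell k = x.cell (-k) then (g x h).inner.ncard else 0,
    fun x y l z m hyz => exists_congr fun h => ?_, fun x k hk => ?_⟩
  · rw [hyz]
    refine and_congr_right fun hR => ?_
    rw [(z.isPreconnected_cell m).constant ((g x h).continuousOn.mono ((g x h).disjoint_cell hR))
      (hyz ▸ y.cornerPt_mem_cell l) (z.cornerPt_mem_cell m)]
  · have hx : ∃ k, x.cell k = x.cell (-k) := ⟨k, hk⟩
    have hR := (g x hx).cell_eq k hk
    have hw : ∀ y, y ≠ x → ∀ l, y.cell l ≠ x.cell k →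
        (g x hx).w (y.cornerPt l) = (g x hx).w y.point := fun y hy l hl =>
      (g x hx).w_eq hy (hR ▸ hl) (mem_insert_of_mem _ (y.cornerPt_mem_cell l))
    have hadj : ∀ l : Corner, l.1 * l.2 = -(k.1 * k.2) → x.cell l ≠ (g x hx).R := fun l hl h => by
      have := x.mul_eq_mul_of_cell_eq (h.trans hR.symm)
      rw [hl] at this
      exact units_ne_neg_self _ this.symm
    refine ⟨fun y hy l l' hl hl' => exists_congr fun h => ?_, ?_, fun y l hl hne hS => ?_⟩
    · rw [hw y hy l hl, hw y hy l' hl', ← hR]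
      simp [hl, hl']
    · have hside := (g x hx).side k hk
      have h1 := hadj (k.1, -k.2) (by simp)
      have h2 := hadj (-k.1, k.2) (by simp)
      simp only [hx, h1, h2, ne_eq, not_false_eq_true, true_and, exists_true_left]
      exact hside
    · have hy : ∃ k, y.cell k = y.cell (-k) := ⟨l, hl⟩
      obtain ⟨h, -, hwc⟩ := hS
      have hyx : y ≠ x := by
        rintro rfl
        exact hne (((g y hx).cell_eq l hl).trans hR.symm)
      simp only [dif_pos hx, dif_pos hy]
      refine (g x hx).ncard_inner_lt (g y hy) hb hbp hyx ?_ ?_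
      · rwa [← hR, ← (g y hy).cell_eq l hl]
      · rw [← hw y hyx l hne]
        exact hwc

end LinkDiagram

/-! ### Regions in the plane and on the sphere. -/

namespace LinkDiagram

variable {D : LinkDiagram} {S : Type} [TopologicalSpace S] {e : ℂ → S}

/-- An inclusion of the plane in a surface that is compatible with the regions of a diagram. -/
structure IsInclusion (D : LinkDiagram) (e : ℂ → S) : Prop where
  isOpenEmbedding : Topology.IsOpenEmbedding e
  component_eq : ∀ p q, p ∉ D.image → q ∉ D.image →
    connectedComponentIn (e '' D.image)ᶜ (e p) = connectedComponentIn (e '' D.image)ᶜ (e q) →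
    connectedComponentIn D.imageᶜ p = connectedComponentIn D.imageᶜ q

theorem isInclusion_inPlane : D.IsInclusion inPlane :=
  ⟨Topology.IsOpenEmbedding.id, fun p q _ _ h => by simpa [inPlane] using h⟩

theorem isPreconnected_compl_closedBall (r : ℝ) (hr : 0 ≤ r) :
    IsPreconnected (Metric.closedBall (0 : ℂ) r)ᶜ := by
  have hrank : 1 < Module.rank ℝ ℂ := by rw [Complex.rank_real_complex]; norm_num
  have : (Metric.closedBall (0 : ℂ) r)ᶜ = (fun z : ℝ × ℂ => z.1 • z.2) ''
      (Ioi r ×ˢ Metric.sphere (0 : ℂ) 1) := by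
    ext z
    simp only [mem_compl_iff, mem_closedBall_zero_iff, not_le, mem_image, mem_prod, mem_Ioi,
      mem_sphere_zero_iff_norm, Prod.exists]
    constructor
    · intro hz
      have h0 : ‖z‖ ≠ 0 := (hr.trans_lt hz).ne'
      refine ⟨‖z‖, ‖z‖⁻¹ • z, ⟨hz, ?_⟩, ?_⟩
      · rw [norm_smul, norm_inv, norm_norm, inv_mul_cancel₀ h0]
      · rw [smul_smul, mul_inv_cancel₀ h0, one_smul]
    · rintro ⟨c, w, ⟨hc, hw⟩, rfl⟩
      rw [norm_smul, hw, mul_one]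
      exact hc.trans_le (Real.le_norm_self c)
  rw [this]
  exact (isPreconnected_Ioi.prod (isPreconnected_sphere hrank 0 1)).image _
    (by fun_prop)

/-- The exterior of a large disc is connected and misses the link, so it lies in a single plane
component. Adding infinity to that component only, each plane component and the union of the others
give disjoint open sets covering the complement on the sphere; thus infinity merges no components.
-/
theorem isInclusion_inSphere : D.IsInclusion inSphere := by
  refine ⟨OnePoint.isOpenEmbedding_coe, fun p q hp hq h => ?_⟩
  have hinj : Function.Injective inSphere := OnePoint.coe_injective
  have hmem : ∀ z, z ∉ D.image → inSphere z ∈ (inSphere '' D.image)ᶜ := fun z hz hz' =>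
    hz ((hinj.mem_set_image).1 hz')
  obtain ⟨r, hr0, hr⟩ : ∃ r, 0 ≤ r ∧ D.image ⊆ Metric.closedBall 0 r := by
    obtain ⟨r, hr⟩ := D.isCompact_image.isBounded.subset_closedBall (0 : ℂ)
    exact ⟨max r 0, le_max_right _ _,
      hr.trans (Metric.closedBall_subset_closedBall (le_max_left _ _))⟩
  have hopen : IsOpen D.imageᶜ := D.isCompact_image.isClosed.isOpen_compl
  set C := connectedComponentIn D.imageᶜ p with hC
  have hCo : IsOpen C := hopen.connectedComponentIn
  have hCo' : IsOpen (D.imageᶜ \ C) := by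
    rw [isOpen_iff_mem_nhds]
    rintro z ⟨hz, hzC⟩
    refine mem_of_superset (hopen.connectedComponentIn.mem_nhds (mem_connectedComponentIn hz))
      fun y hy => ⟨connectedComponentIn_subset _ _ hy, fun hyC => hzC ?_⟩
    rw [hC, connectedComponentIn_eq hyC, ← connectedComponentIn_eq hy]
    exact mem_connectedComponentIn hz
  have hE : IsPreconnected (Metric.closedBall (0 : ℂ) r)ᶜ := isPreconnected_compl_closedBall r hr0
  have hEs : (Metric.closedBall (0 : ℂ) r)ᶜ ⊆ D.imageᶜ := compl_subset_compl.2 hr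
  -- the points of the sphere over `A`, with the point at infinity if `A` is a neighbourhood of it
  let T : Set ℂ → Set (OnePoint ℂ) := fun A =>
    {z | (z = OnePoint.infty ∧ (Metric.closedBall (0 : ℂ) r)ᶜ ⊆ A) ∨ ∃ y ∈ A, inSphere y = z}
  have hTpre : ∀ A, ((↑) : ℂ → OnePoint ℂ) ⁻¹' T A = A := fun A => by
    ext z
    simp only [T, mem_preimage, mem_ofPred_eq, OnePoint.coe_ne_infty, false_and, false_or]
    exact ⟨fun ⟨y, hy, hyz⟩ => hinj hyz ▸ hy, fun hz => ⟨z, hz, rfl⟩⟩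
  have hTo : ∀ A, IsOpen A → IsOpen (T A) := fun A hA => by
    rw [OnePoint.isOpen_def, hTpre]
    refine ⟨fun hinf => ?_, hA⟩
    have hsub : (Metric.closedBall (0 : ℂ) r)ᶜ ⊆ A := by
      rcases hinf with h | ⟨y, -, hy⟩
      · exact h.2
      · exact absurd hy (OnePoint.coe_ne_infty y)
    exact (isCompact_closedBall (0 : ℂ) r).of_isClosed_subset hA.isClosed_compl
      (compl_subset_comm.1 hsub)
  have hcover : (inSphere '' D.image)ᶜ ⊆ T C ∪ T (D.imageᶜ \ C) := by
    intro z hz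
    induction z using OnePoint.rec with
    | infty =>
      by_cases hEC : (Metric.closedBall (0 : ℂ) r)ᶜ ⊆ C
      · exact Or.inl (Or.inl ⟨rfl, hEC⟩)
      · refine Or.inr (Or.inl ⟨rfl, fun y hy => ⟨hEs hy, fun hyC => hEC ?_⟩⟩)
        rw [hC, connectedComponentIn_eq hyC]
        exact hE.subset_connectedComponentIn hy hEs
    | coe z =>
      have hz' : z ∉ D.image := fun h => hz ⟨z, h, rfl⟩
      by_cases hzC : z ∈ C
      · exact Or.inl (Or.inr ⟨z, hzC, rfl⟩)
      · exact Or.inr (Or.inr ⟨z, ⟨hz', hzC⟩, rfl⟩)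
  have hr1 : ((Metric.closedBall (0 : ℂ) r)ᶜ).Nonempty :=
    ⟨((r + 1 : ℝ) : ℂ), by
      rw [mem_compl_iff, mem_closedBall_zero_iff, Complex.norm_real, not_le,
        Real.norm_of_nonneg (by linarith)]
      linarith⟩
  have hdisj : Disjoint (T C) (T (D.imageᶜ \ C)) := by
    rw [Set.disjoint_left]
    rintro z (⟨rfl, h1⟩ | ⟨y, hy, rfl⟩) (⟨h2, h3⟩ | ⟨y', hy', h2⟩)
    · obtain ⟨w, hw⟩ := hr1
      exact (h3 hw).2 (h1 hw)
    · exact OnePoint.coe_ne_infty y' h2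
    · exact OnePoint.coe_ne_infty y h2
    · exact hy'.2 (hinj h2 ▸ hy)
  have hpT : inSphere p ∈ T C := Or.inr ⟨p, mem_connectedComponentIn hp, rfl⟩
  have hsub := isPreconnected_connectedComponentIn.subset_left_of_subset_union (hTo _ hCo)
    (hTo _ hCo') hdisj ((connectedComponentIn_subset _ (inSphere p)).trans hcover)
    ⟨inSphere p, mem_connectedComponentIn (hmem p hp), hpT⟩
  have hqT : inSphere q ∈ T C := hsub (by
    rw [h]; exact mem_connectedComponentIn (hmem q hq))
  rcases hqT with ⟨h1, -⟩ | ⟨y, hy, hyq⟩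
  · exact absurd h1 (OnePoint.coe_ne_infty q)
  · rw [← hinj hyq]
    exact connectedComponentIn_eq hy

namespace IsInclusion

theorem notMem (he : D.IsInclusion e) {z : ℂ} (hz : z ∉ D.image) : e z ∈ (e '' D.image)ᶜ :=
  fun h => hz (he.isOpenEmbedding.injective.mem_set_image.1 h)

/-- The region at a corner of a crossing. -/
noncomputable def region (he : D.IsInclusion e) (x : D.Crossing) (k : Corner) : D.Region e :=
  ⟨connectedComponentIn (e '' D.image)ᶜ (e (x.cornerPt k)), e (x.cornerPt k),
    he.notMem (x.cornerPt_notMem_image k), rfl⟩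

theorem image_cell_subset (he : D.IsInclusion e) (x : D.Crossing) (k : Corner) :
    e '' x.cell k ⊆ (he.region x k).1 :=
  ((x.isPreconnected_cell k).image e
    he.isOpenEmbedding.continuous.continuousOn).subset_connectedComponentIn
    (mem_image_of_mem e (x.cornerPt_mem_cell k)) (by
      rintro _ ⟨z, hz, rfl⟩
      exact he.notMem (x.cell_subset k hz))

theorem eq_of_mem {R R' : D.Region e} {z : S} (h : z ∈ R.1) (h' : z ∈ R'.1) : R = R' := by
  obtain ⟨R, p, hp, rfl⟩ := R
  obtain ⟨R', q, hq, rfl⟩ := R'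
  exact Subtype.ext ((connectedComponentIn_eq h).trans (connectedComponentIn_eq h').symm)

theorem region_eq_iff (he : D.IsInclusion e) {x y : D.Crossing} {k l : Corner} :
    he.region x k = he.region y l ↔ x.cell k = y.cell l := by
  constructor
  · intro h
    exact he.component_eq _ _ (x.cornerPt_notMem_image k) (y.cornerPt_notMem_image l)
      (congrArg Subtype.val h)
  · intro h
    refine eq_of_mem (he.image_cell_subset x k (mem_image_of_mem e (x.cornerPt_mem_cell k)))
      (he.image_cell_subset y l ?_)
    rw [← h]
    exact mem_image_of_mem e (x.cornerPt_mem_cell k)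

theorem eventually_mem_region (he : D.IsInclusion e) (x : D.Crossing) (k : Corner) :
    ∀ᶠ t : ℝ in 𝓝[>] 0, e (x.point + t • x.direction k) ∈ (he.region x k).1 :=
  (x.eventually_direction_mem_sector k).mono fun _ h =>
    he.image_cell_subset x k (mem_image_of_mem e (x.sector_subset_cell k h))

/-- The ray into a corner eventually lies in the region at that corner, and regions sharing a point
coincide. -/
theorem touches_iff (he : D.IsInclusion e) {R : D.Region e} {x : D.Crossing} {k : Corner} :
    D.Touches e R x k ↔ R = he.region x k := by
  constructor
  · intro h
    obtain ⟨t, h1, h2⟩ := (h.and (he.eventually_mem_region x k)).exists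
    exact eq_of_mem h1 h2
  · rintro rfl
    exact he.eventually_mem_region x k

theorem mem_frontier_iff (he : D.IsInclusion e) {R : D.Region e} {x : D.Crossing} :
    e x.point ∈ frontier R.1 ↔ ∃ k, R = he.region x k := by
  have hsub : R.1 ⊆ (e '' D.image)ᶜ := by
    obtain ⟨R, p, hp, rfl⟩ := R
    exact connectedComponentIn_subset _ _
  constructor
  · intro h
    have hN := he.isOpenEmbedding.image_mem_nhds.2 x.eventually_mem_sector
    obtain ⟨_, ⟨z, hz, rfl⟩, hzR⟩ := mem_closure_iff_nhds.1 (frontier_subset_closure h) _ hN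
    obtain ⟨k, hk⟩ := hz fun hzi => hsub hzR (mem_image_of_mem e hzi)
    exact ⟨k, eq_of_mem hzR (he.image_cell_subset x k
      (mem_image_of_mem e (x.sector_subset_cell k hk)))⟩
  · rintro ⟨k, rfl⟩
    refine ⟨?_, fun h => hsub (interior_subset h) (mem_image_of_mem e x.point_mem_image)⟩
    exact mem_closure_of_tendsto ((he.isOpenEmbedding.continuous.tendsto _).comp
      (tendsto_add_smul x.point (x.direction k))) (he.eventually_mem_region x k)

end IsInclusion

end LinkDiagram

/-! ### Corner signs and the alternating matrices. -/

namespace LinkDiagram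

variable {D : LinkDiagram} {S : Type} [TopologicalSpace S] {e : ℂ → S}

theorem sum_corner (k : Corner) (f : Corner → ℤ) :
    ∑ l, f l = f k + f (-k) + (f (k.1, -k.2) + f (-k.1, k.2)) := by
  obtain ⟨a, b⟩ := k
  rw [Fintype.sum_prod_type]
  simp only [UnitsInt.univ, Finset.sum_insert (show (1 : ℤˣ) ∉ ({-1} : Finset ℤˣ) by decide),
    Finset.sum_singleton, Prod.neg_mk]
  rcases Int.units_eq_one_or a with rfl | rfl <;> rcases Int.units_eq_one_or b with rfl | rfl <;>
    (try simp only [neg_neg]) <;> ring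

namespace Crossing

/-- The sign of a corner: `1` if it is positive and `-1` otherwise. -/
noncomputable def cornerSign (x : D.Crossing) (k : Corner) : ℤˣ := -x.sign * (k.1 * k.2)

theorem isPositiveCorner_iff_cornerSign (x : D.Crossing) (k : Corner) :
    x.IsPositiveCorner k ↔ x.cornerSign k = 1 := by
  rw [isPositiveCorner_iff, cornerSign, eq_comm, mul_eq_one_iff_eq_inv, Int.units_inv_eq_self]

theorem cornerSign_eq_neg_one_iff (x : D.Crossing) (k : Corner) :
    x.cornerSign k = -1 ↔ ¬ x.IsPositiveCorner k := by
  rw [isPositiveCorner_iff_cornerSign]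
  rcases Int.units_eq_one_or (x.cornerSign k) with h | h <;> rw [h] <;> decide

theorem cornerSign_eq_of_cell_eq (x : D.Crossing) {k l : Corner} (h : x.cell k = x.cell l) :
    x.cornerSign k = x.cornerSign l := by
  rw [cornerSign, cornerSign, x.mul_eq_mul_of_cell_eq h]

theorem cornerSign_neg (x : D.Crossing) (k : Corner) : x.cornerSign (-k) = x.cornerSign k := by
  simp [cornerSign]

theorem cornerSign_flip (x : D.Crossing) (k : Corner) :
    x.cornerSign (k.1, -k.2) = -x.cornerSign k ∧ x.cornerSign (-k.1, k.2) = -x.cornerSign k := by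
  simp [cornerSign]

/-- Corner signs alternate around the crossing, while the two pairs of opposite corners have equal
sums of winding numbers; any constant cancels as well. -/
theorem sum_cornerSign_mul_cornerWinding (x : D.Crossing) (c : ℤ) :
    ∑ l, (x.cornerSign l : ℤ) * (x.cornerWinding l - c) = 0 := by
  rw [sum_corner (1, 1), cornerSign_neg, (x.cornerSign_flip _).1, (x.cornerSign_flip _).2]
  have h1 := x.cornerWinding_formula (-(1, 1))
  have h2 := x.cornerWinding_formula ((1 : ℤˣ), -1)
  have h3 := x.cornerWinding_formula (-1, (1 : ℤˣ))
  simp only [Prod.neg_mk, Units.val_neg, Units.val_one] at h1 h2 h3 ⊢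
  have : x.cornerWinding (-1, -1) = x.cornerWinding (1, -1) + x.cornerWinding (-1, 1)
      - x.cornerWinding (1, 1) := by linarith
  rw [this]
  ring

theorem cornerWinding_flip (x : D.Crossing) (k : Corner) :
    x.cornerWinding (k.1, -k.2) - x.cornerWinding k = -(x.sign * k.2 : ℤˣ) ∧
      x.cornerWinding (-k.1, k.2) - x.cornerWinding k = (x.sign * k.1 : ℤˣ) := by
  have h1 := x.cornerWinding_formula k
  have h2 := x.cornerWinding_formula (k.1, -k.2)
  have h3 := x.cornerWinding_formula (-k.1, k.2)
  push_cast at h1 h2 h3 ⊢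
  constructor <;> linarith

/-- The colour of a corner in the checkerboard colouring of the regions. -/
noncomputable def color (x : D.Crossing) (k : Corner) : ℤˣ := (x.cornerWinding k).negOnePow

/-- Passing to an adjacent corner changes the winding number by one and reverses the corner sign, so
sign times colour depends only on the crossing. This is the row sign in `exists_signs`. -/
theorem cornerSign_eq_mul_color (x : D.Crossing) (k : Corner) :
    x.cornerSign k = (x.cornerSign (1, 1) * x.color (1, 1)) * x.color k := by
  have h : x.cornerWinding k = x.cornerWinding (1, 1) ∧ k.1 * k.2 = 1 ∨
      (Odd (x.cornerWinding k - x.cornerWinding (1, 1)) ∧ k.1 * k.2 = -1) ∨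
      (Even (x.cornerWinding k - x.cornerWinding (1, 1)) ∧ k.1 * k.2 = 1) := by
    have hf := x.cornerWinding_formula k
    obtain ⟨a, b⟩ := k
    have hs := Int.units_eq_one_or x.sign
    rcases Int.units_eq_one_or a with rfl | rfl <;>
    rcases Int.units_eq_one_or b with rfl | rfl <;>
    rcases hs with hs | hs <;> rw [hs] at hf <;> push_cast at hf
    all_goals first
      | (refine Or.inr (Or.inr ⟨⟨0, ?_⟩, by decide⟩); linarith)
      | (refine Or.inr (Or.inl ⟨⟨0, ?_⟩, by decide⟩); linarith)
      | (refine Or.inr (Or.inl ⟨⟨-1, ?_⟩, by decide⟩); linarith)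
  have hcol : x.color k = k.1 * k.2 * x.color (1, 1) := by
    have hw : x.cornerWinding k =
        (x.cornerWinding k - x.cornerWinding (1, 1)) + x.cornerWinding (1, 1) := by ring
    rw [color, color, hw, Int.negOnePow_add]
    rcases h with ⟨h1, h2⟩ | ⟨h1, h2⟩ | ⟨h1, h2⟩
    · rw [h1, h2, sub_self, Int.negOnePow_zero]
    · rw [Int.negOnePow_odd _ h1, h2]
    · rw [Int.negOnePow_even _ h1, h2]
  rw [hcol, cornerSign, cornerSign]
  have := Int.units_mul_self (x.color (1, 1))
  calc -x.sign * (k.1 * k.2) = -x.sign * (k.1 * k.2) * 1 := by rw [mul_one]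
    _ = -x.sign * (k.1 * k.2) * (x.color (1, 1) * x.color (1, 1)) := by rw [this]
    _ = _ := by simp only [mul_one]; ac_rfl

end Crossing

namespace IsInclusion

theorem matrixA1_region (he : D.IsInclusion e) (x : D.Crossing) (k : Corner) :
    D.matrixA1 e x (he.region x k) = x.cornerSign k := by
  rw [matrixA1]
  by_cases hp : x.IsPositiveCorner k
  · rw [if_pos ⟨k, he.touches_iff.2 rfl, hp⟩, (x.isPositiveCorner_iff_cornerSign k).1 hp]
    rfl
  · have h1 := (x.cornerSign_eq_neg_one_iff k).2 hp
    rw [if_neg, if_pos ⟨k, he.touches_iff.2 rfl, hp⟩, h1]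
    · rfl
    · rintro ⟨l, hl, hpl⟩
      have h2 := x.cornerSign_eq_of_cell_eq (he.region_eq_iff.1 (he.touches_iff.1 hl))
      rw [h1, (x.isPositiveCorner_iff_cornerSign l).1 hpl] at h2
      exact absurd h2 (by decide)

theorem matrixA1_eq_zero (he : D.IsInclusion e) {x : D.Crossing} {R : D.Region e} (h : ∀ k, R ≠ he.region x k) :
    D.matrixA1 e x R = 0 := by
  rw [matrixA1, if_neg, if_neg]
  · rintro ⟨k, hk, -⟩; exact h k (he.touches_iff.1 hk)
  · rintro ⟨k, hk, -⟩; exact h k (he.touches_iff.1 hk)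

theorem matrixA2_of_touches (he : D.IsInclusion e) {x : D.Crossing} {k : Corner} (h : x.cell k = x.cell (-k)) :
    D.matrixA2 e x (he.region x k) = 2 * x.cornerSign k := by
  rw [matrixA2, if_pos ⟨k, he.touches_iff.2 rfl, he.touches_iff.2 (he.region_eq_iff.2 h)⟩,
    he.matrixA1_region]

theorem matrixA2_of_not_touches (he : D.IsInclusion e) {x : D.Crossing} {R : D.Region e}
    (h : ∀ k, R = he.region x k → x.cell k ≠ x.cell (-k)) :
    D.matrixA2 e x R = D.matrixA1 e x R := by
  rw [matrixA2, if_neg]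
  rintro ⟨k, h1, h2⟩
  have h1' := he.touches_iff.1 h1
  have h2' := he.touches_iff.1 h2
  exact h k h1' (he.region_eq_iff.1 (h1'.symm.trans h2'))

/-- Adjacent corners lie in different regions, so a region meets a crossing at one corner or at two
opposite ones. Opposite corners have equal sign, which accounts for the factor two. -/
theorem matrixA2_eq_sum (he : D.IsInclusion e) [DecidableEq (D.Region e)] (x : D.Crossing) (R : D.Region e) :
    D.matrixA2 e x R = ∑ k, (x.cornerSign k : ℤ) * if R = he.region x k then 1 else 0 := by
  by_cases hR : ∃ k, R = he.region x k
  · obtain ⟨k, rfl⟩ := hR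
    have hne : ∀ l : Corner, l.1 * l.2 = -(k.1 * k.2) → he.region x k ≠ he.region x l :=
      fun l hl h => by
        have := x.mul_eq_mul_of_cell_eq (he.region_eq_iff.1 h)
        rw [hl] at this
        exact units_ne_neg_self _ this
    rw [sum_corner k, if_pos rfl, if_neg (hne (k.1, -k.2) (by simp)),
      if_neg (hne (-k.1, k.2) (by simp)), x.cornerSign_neg]
    by_cases hk : x.cell k = x.cell (-k)
    · rw [he.matrixA2_of_touches hk, if_pos (he.region_eq_iff.2 hk)]
      ring
    · rw [he.matrixA2_of_not_touches, he.matrixA1_region,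
        if_neg fun h => hk (he.region_eq_iff.1 h)]
      · ring
      · intro l hl hl'
        have hkl := he.region_eq_iff.1 hl
        rcases corner_eq_or k l with h | h | h | h
        · exact hk (h ▸ hl')
        · rw [h] at hkl; exact hk hkl
        · exact hne l (by rw [h]; simp) hl
        · exact hne l (by rw [h]; simp) hl
  · push Not at hR
    rw [he.matrixA2_of_not_touches (fun k hk => absurd hk (hR k)), he.matrixA1_eq_zero hR]
    exact (Finset.sum_eq_zero fun k _ => by rw [if_neg (hR k), mul_zero]).symm

theorem hom_apply (A : Matrix D.Crossing (D.Region e) ℤ) (u : D.Region e →₀ ℤ) (x : D.Crossing) :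
    D.hom e A u x = ∑ R ∈ u.support, u R * A x R := by
  rw [hom, Finsupp.linearCombination_apply, Finsupp.sum, Finset.sum_apply]
  rfl

theorem PhiA2_apply (he : D.IsInclusion e) (u : D.Region e →₀ ℤ) (x : D.Crossing) :
    D.PhiA2 e u x = ∑ k, (x.cornerSign k : ℤ) * u (he.region x k) := by
  classical
  rw [PhiA2, hom_apply]
  simp only [he.matrixA2_eq_sum, Finset.mul_sum]
  rw [Finset.sum_comm]
  refine Finset.sum_congr rfl fun k _ => ?_
  simp only [mul_ite, mul_one, mul_zero, Finset.sum_ite_eq', Finsupp.mem_support_iff]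
  split_ifs with h
  · ring
  · rw [not_not.1 h, mul_zero]

/-- A function on the regions with prescribed values at the corners of the crossings. -/
theorem exists_finsupp (he : D.IsInclusion e) (f : D.Crossing → Corner → ℤ)
    (hf : ∀ x y k l, x.cell k = y.cell l → f x k = f y l) :
    ∃ u : D.Region e →₀ ℤ, ∀ x k, u (he.region x k) = f x k := by
  classical
  have hfin : (range fun p : D.Crossing × Corner => he.region p.1 p.2).Finite := finite_range _
  let g : D.Region e → ℤ := fun R => if h : ∃ p : D.Crossing × Corner, R = he.region p.1 p.2
    then f h.choose.1 h.choose.2 else 0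
  refine ⟨Finsupp.ofSupportFinite g (hfin.subset fun R hR => ?_), fun x k => ?_⟩
  · by_contra hcon
    refine hR (dif_neg ?_)
    rintro ⟨p, hp⟩
    exact hcon ⟨p, hp.symm⟩
  · have h : ∃ p : D.Crossing × Corner, he.region x k = he.region p.1 p.2 := ⟨(x, k), rfl⟩
    change g _ = _
    simp only [g]
    rw [dif_pos h]
    exact (hf _ _ _ _ (he.region_eq_iff.1 h.choose_spec)).symm

theorem exists_touches_of_PhiA2_sub_ne_zero (he : D.IsInclusion e) {u : D.Region e →₀ ℤ} {x : D.Crossing}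
    (h : (D.PhiA2 e u - D.PhiA1 e u) x ≠ 0) :
    ∃ k, x.cell k = x.cell (-k) ∧ u (he.region x k) ≠ 0 := by
  rw [Pi.sub_apply, PhiA2, PhiA1, hom_apply, hom_apply, ← Finset.sum_sub_distrib] at h
  obtain ⟨R, hR, hne⟩ := Finset.exists_ne_zero_of_sum_ne_zero h
  by_contra! hcon
  refine hne ?_
  rw [he.matrixA2_of_not_touches, sub_self]
  rintro k rfl hk
  exact (Finsupp.mem_support_iff.1 hR) (hcon k hk)

theorem mem_of_forall_single_mem {M : Submodule ℤ (D.Crossing → ℤ)} {v : D.Crossing → ℤ}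
    [DecidableEq D.Crossing] (h : ∀ x, v x ≠ 0 → Pi.single x 1 ∈ M) : v ∈ M := by
  cases nonempty_fintype D.Crossing
  rw [pi_eq_sum_univ' v]
  refine M.sum_mem fun x _ => ?_
  by_cases hx : v x = 0
  · rw [hx, zero_smul]; exact M.zero_mem
  · refine M.smul_mem _ ?_
    exact h x hx

/-! ### Unit vectors of reducible crossings and the alternating images. -/

open Classical in
theorem single_mem_range (he : D.IsInclusion e) :
    ∀ x : D.Crossing, (∃ k, x.cell k = x.cell (-k)) →
      (Pi.single x 1 : D.Crossing → ℤ) ∈ LinearMap.range (D.PhiA2 e) ∧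
      (Pi.single x 1 : D.Crossing → ℤ) ∈ LinearMap.range (D.PhiA1 e) := by
  obtain ⟨S, N, hS, hmain⟩ := exists_inside D
  intro x
  induction hn : N x using Nat.strong_induction_on generalizing x with
  | _ n ih =>
  subst hn
  rintro ⟨k, hk⟩
  obtain ⟨hconst, hside, hlt⟩ := hmain x k hk
  -- Winding numbers are normalised to vanish on the region containing the loop, so cutting them off
  -- to `0` outside is consistent at crossings that also touch that region.
  obtain ⟨u, hu⟩ := he.exists_finsupp
    (fun y l => if y.cell l ≠ x.cell k ∧ S x y l then y.cornerWinding l - x.cornerWinding k else 0)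
    fun y z l m h => by
      rw [h, Crossing.cornerWinding_eq h]
      simp only [hS x y l z m h]
  have hother : ∀ y, y ≠ x → D.PhiA2 e u y = 0 := fun y hy => by
    rw [he.PhiA2_apply]
    by_cases hex : ∃ l, y.cell l ≠ x.cell k ∧ S x y l
    · obtain ⟨l₀, hl₀, hSl₀⟩ := hex
      rw [← y.sum_cornerSign_mul_cornerWinding (x.cornerWinding k)]
      refine Finset.sum_congr rfl fun l _ => ?_
      rw [hu]
      by_cases hl : y.cell l = x.cell k
      · rw [if_neg fun h => h.1 hl, Crossing.cornerWinding_eq hl, sub_self]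
      · rw [if_pos ⟨hl, (hconst y hy l l₀ hl hl₀).2 hSl₀⟩]
    · refine Finset.sum_eq_zero fun l _ => ?_
      rw [hu, if_neg fun h => hex ⟨l, h⟩, mul_zero]
  -- The corners `k` and `-k` have label `0`. Exactly one of the other two is inside, and its
  -- winding number differs by one from that at `k`.
  obtain ⟨c, hc⟩ : ∃ c : ℤˣ, D.PhiA2 e u x = c := by
    have hadj : ∀ l : Corner, l.1 * l.2 = -(k.1 * k.2) → x.cell l ≠ x.cell k := fun l hl h => by
      have := x.mul_eq_mul_of_cell_eq h
      rw [hl] at this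
      exact units_ne_neg_self _ this.symm
    have h1 := hadj (k.1, -k.2) (by simp)
    have h2 := hadj (-k.1, k.2) (by simp)
    obtain ⟨f1, f2⟩ := x.cornerWinding_flip k
    rw [he.PhiA2_apply, sum_corner k, hu, hu, hu, hu, if_neg (fun h => h.1 rfl),
      if_neg (fun h => h.1 hk.symm), f1, f2]
    by_cases hin : S x x (-k.1, k.2)
    · rw [if_neg fun h => hside.1 h.2 hin, if_pos ⟨h2, hin⟩]
      exact ⟨x.cornerSign (-k.1, k.2) * (x.sign * k.1), by push_cast; ring⟩
    · rw [if_pos ⟨h1, hside.2 hin⟩, if_neg fun h => hin h.2]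
      exact ⟨x.cornerSign (k.1, -k.2) * -(x.sign * k.2), by push_cast; ring⟩
  have hval : (Pi.single x 1 : D.Crossing → ℤ) = (c : ℤ) • D.PhiA2 e u := by
    ext y
    rw [Pi.smul_apply, smul_eq_mul]
    by_cases hy : y = x
    · subst hy
      rw [hc, Int.units_coe_mul_self, Pi.single_eq_same]
    · rw [hother y hy, mul_zero, Pi.single_eq_of_ne hy]
  refine ⟨hval ▸ Submodule.smul_mem _ _ ⟨u, rfl⟩, ?_⟩
  rw [hval]
  refine Submodule.smul_mem _ _ ?_
  -- A nonzero entry requires a nonzero label on a region touching `y` at opposite corners. That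
  -- region is inside and is not the one at `k`, so `N y < N x` and the induction hypothesis
  -- supplies the unit vector at `y`.
  have hdiff : D.PhiA2 e u - D.PhiA1 e u ∈ LinearMap.range (D.PhiA1 e) := by
    refine mem_of_forall_single_mem fun y hy => ?_
    obtain ⟨l, hl, hul⟩ := he.exists_touches_of_PhiA2_sub_ne_zero hy
    rw [hu] at hul
    have hin : y.cell l ≠ x.cell k ∧ S x y l := by
      by_contra hcon
      exact hul (if_neg hcon)
    exact (ih (N y) (hlt y l hl hin.1 hin.2) y rfl ⟨l, hl⟩).2
  have := Submodule.add_mem _ hdiff (LinearMap.mem_range_self (D.PhiA1 e) u)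
  rwa [sub_add_cancel] at this

theorem range_PhiA1_eq (he : D.IsInclusion e) : LinearMap.range (D.PhiA1 e) = LinearMap.range (D.PhiA2 e) := by
  classical
  have key : ∀ u, D.PhiA2 e u - D.PhiA1 e u ∈
      LinearMap.range (D.PhiA2 e) ⊓ LinearMap.range (D.PhiA1 e) := fun u => by
    refine mem_of_forall_single_mem fun y hy => ?_
    obtain ⟨l, hl, -⟩ := he.exists_touches_of_PhiA2_sub_ne_zero hy
    exact he.single_mem_range y ⟨l, hl⟩
  apply le_antisymm
  · rintro _ ⟨u, rfl⟩
    have := Submodule.sub_mem _ (LinearMap.mem_range_self (D.PhiA2 e) u) (key u).1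
    rwa [sub_sub_cancel] at this
  · rintro _ ⟨u, rfl⟩
    have := Submodule.add_mem _ (key u).2 (LinearMap.mem_range_self (D.PhiA1 e) u)
    rwa [sub_add_cancel] at this

/-! ### The definite matrices and the transfer by signs. -/

theorem matrixD1_region (he : D.IsInclusion e) (x : D.Crossing) (k : Corner) :
    D.matrixD1 e x (he.region x k) = 1 := by
  rw [matrixD1, if_pos (he.mem_frontier_iff.2 ⟨k, rfl⟩)]

theorem matrixD1_eq_zero (he : D.IsInclusion e) {x : D.Crossing} {R : D.Region e} (h : ∀ k, R ≠ he.region x k) :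
    D.matrixD1 e x R = 0 := by
  rw [matrixD1, if_neg fun hf => ?_]
  obtain ⟨k, hk⟩ := he.mem_frontier_iff.1 hf
  exact h k hk

theorem matrixD2_of_touches (he : D.IsInclusion e) {x : D.Crossing} {k : Corner} (h : x.cell k = x.cell (-k)) :
    D.matrixD2 e x (he.region x k) = 2 := by
  have hne : k ≠ -k := fun h' => units_ne_neg_self k.1 (congrArg Prod.fst h')
  rw [matrixD2,
    if_pos ⟨k, -k, hne, he.touches_iff.2 rfl, he.touches_iff.2 (he.region_eq_iff.2 h)⟩]

theorem matrixD2_of_not_touches (he : D.IsInclusion e) {x : D.Crossing} {R : D.Region e}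
    (h : ∀ k, R = he.region x k → x.cell k ≠ x.cell (-k)) :
    D.matrixD2 e x R = D.matrixD1 e x R := by
  rw [matrixD2, if_neg]
  rintro ⟨k, l, hkl, h1, h2⟩
  have h1' := he.touches_iff.1 h1
  have h2' := he.touches_iff.1 h2
  have hc := he.region_eq_iff.1 (h1'.symm.trans h2')
  have hmul := x.mul_eq_mul_of_cell_eq hc
  rcases corner_eq_or k l with h' | h' | h' | h'
  · exact hkl h'.symm
  · rw [h'] at hc; exact h k h1' hc
  · rw [h'] at hmul; simp only [mul_neg] at hmul; exact units_ne_neg_self _ hmul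
  · rw [h'] at hmul; simp only [neg_mul] at hmul; exact units_ne_neg_self _ hmul

/-- The alternating matrices are obtained from the definite ones by changing signs of rows and
columns. -/
theorem exists_signs (he : D.IsInclusion e) : ∃ (ε : D.Crossing → ℤˣ) (δ : D.Region e → ℤˣ),
    (∀ x R, D.matrixA1 e x R = ε x * (δ R * D.matrixD1 e x R)) ∧
    ∀ x R, D.matrixA2 e x R = ε x * (δ R * D.matrixD2 e x R) := by
  classical
  let δ : D.Region e → ℤˣ := fun R => if h : ∃ p : D.Crossing × Corner, R = he.region p.1 p.2
    then h.choose.1.color h.choose.2 else 1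
  have hδ : ∀ x k, δ (he.region x k) = x.color k := fun x k => by
    have h : ∃ p : D.Crossing × Corner, he.region x k = he.region p.1 p.2 := ⟨(x, k), rfl⟩
    simp only [δ]
    rw [dif_pos h, Crossing.color, Crossing.color,
      ← Crossing.cornerWinding_eq (he.region_eq_iff.1 h.choose_spec)]
  have h1 : ∀ (x : D.Crossing) (R : D.Region e), D.matrixA1 e x R =
      (x.cornerSign (1, 1) * x.color (1, 1) : ℤˣ) * (δ R * D.matrixD1 e x R) := fun x R => by
    by_cases hR : ∃ k, R = he.region x k
    · obtain ⟨k, rfl⟩ := hR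
      rw [he.matrixA1_region, he.matrixD1_region, hδ, mul_one, ← Units.val_mul,
        ← x.cornerSign_eq_mul_color]
    · push Not at hR
      rw [he.matrixA1_eq_zero hR, he.matrixD1_eq_zero hR, mul_zero, mul_zero]
  refine ⟨fun x => x.cornerSign (1, 1) * x.color (1, 1), δ, h1, fun x R => ?_⟩
  by_cases hR : ∃ k, R = he.region x k ∧ x.cell k = x.cell (-k)
  · obtain ⟨k, rfl, hk⟩ := hR
    have := h1 x (he.region x k)
    rw [he.matrixA1_region, he.matrixD1_region] at this
    rw [he.matrixA2_of_touches hk, he.matrixD2_of_touches hk, this]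
    ring
  · have hR' : ∀ k, R = he.region x k → x.cell k ≠ x.cell (-k) := fun k h h' => hR ⟨k, h, h'⟩
    rw [he.matrixA2_of_not_touches hR', he.matrixD2_of_not_touches hR', h1]

/-- Diagonal sign matrices are involutions. To reach the column of `A'` at `R`, solve with `B` for
the image of `δ R` times the basis vector under `A`, then multiply the solution by `δ`; the row
signs cancel. -/
theorem range_hom_eq_of_signs {A B A' B' : Matrix D.Crossing (D.Region e) ℤ}
    {ε : D.Crossing → ℤˣ} {δ : D.Region e → ℤˣ}
    (hA : ∀ x R, A x R = ε x * (δ R * A' x R)) (hB : ∀ x R, B x R = ε x * (δ R * B' x R))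
    (h : LinearMap.range (D.hom e A) ≤ LinearMap.range (D.hom e B)) :
    LinearMap.range (D.hom e A') ≤ LinearMap.range (D.hom e B') := by
  rw [hom, Finsupp.range_linearCombination, Submodule.span_le]
  rintro _ ⟨R, rfl⟩
  obtain ⟨u, hu⟩ := h ⟨Finsupp.single R (δ R : ℤ), rfl⟩
  refine ⟨Finsupp.onFinset u.support (fun Q => δ Q * u Q) (fun Q hQ =>
    Finsupp.mem_support_iff.2 (right_ne_zero_of_mul hQ)), ?_⟩
  ext x
  have hx := congrFun hu x
  rw [hom_apply, hom, Finsupp.linearCombination_single, Pi.smul_apply, smul_eq_mul, hA] at hx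
  have hsum : D.hom e B' (Finsupp.onFinset u.support (fun Q => δ Q * u Q) (fun Q hQ =>
      Finsupp.mem_support_iff.2 (right_ne_zero_of_mul hQ))) x =
      ∑ Q ∈ u.support, δ Q * u Q * B' x Q := by
    rw [hom_apply]
    refine Finset.sum_subset Finsupp.support_onFinset_subset fun Q _ hQ => ?_
    have : (δ Q : ℤ) * u Q = 0 := by simpa using hQ
    rw [Finsupp.onFinset_apply, this, zero_mul]
  rw [hsum]
  have hε := Int.units_coe_mul_self (ε x)
  have hδ := Int.units_coe_mul_self (δ R)
  calc ∑ Q ∈ u.support, (δ Q : ℤ) * u Q * B' x Q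
      = (ε x : ℤ) * ∑ Q ∈ u.support, u Q * B x Q := by
        rw [Finset.mul_sum]
        refine Finset.sum_congr rfl fun Q _ => ?_
        rw [hB]
        linear_combination (-(δ Q * u Q * B' x Q : ℤ)) * hε
    _ = A' x R := by
        rw [hx]
        linear_combination (A' x R * (δ R * δ R : ℤ)) * hε + A' x R * hδ

theorem range_PhiD1_eq (he : D.IsInclusion e) : LinearMap.range (D.PhiD1 e) = LinearMap.range (D.PhiD2 e) := by
  obtain ⟨ε, δ, h1, h2⟩ := he.exists_signs
  exact le_antisymm (range_hom_eq_of_signs h1 h2 he.range_PhiA1_eq.le)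
    (range_hom_eq_of_signs h2 h1 he.range_PhiA1_eq.ge)

end IsInclusion

theorem exists_add_eq_zero_iff {M : Type*} [AddCommGroup M] {f g : M →ₗ[ℤ] (D.Crossing → ℤ)}
    (h : LinearMap.range f = LinearMap.range g) (c : D.Crossing → ℤ) :
    (∃ u, f u + c = 0) ↔ ∃ w, g w + c = 0 := by
  simp only [add_eq_zero_iff_eq_neg]
  exact (SetLike.ext_iff.1 h (-c))

theorem IsInclusion.main (he : D.IsInclusion e) :
    LinearMap.range (D.PhiD1 e) = LinearMap.range (D.PhiD2 e) ∧
      LinearMap.range (D.PhiA1 e) = LinearMap.range (D.PhiA2 e) ∧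
      ∀ c : D.Crossing → ℤ,
        ((∃ u, D.PhiD1 e u + c = 0) ↔ ∃ w, D.PhiD2 e w + c = 0) ∧
        ((∃ u, D.PhiA1 e u + c = 0) ↔ ∃ w, D.PhiA2 e w + c = 0) :=
  ⟨he.range_PhiD1_eq, he.range_PhiA1_eq, fun c =>
    ⟨exists_add_eq_zero_iff he.range_PhiD1_eq c, exists_add_eq_zero_iff he.range_PhiA1_eq c⟩⟩

end LinkDiagram

theorem mainTheorem3 (D : LinkDiagram) (hD : Nonempty D.Crossing) :
    -- regions on the plane
    (LinearMap.range (D.PhiD1 LinkDiagram.inPlane) = LinearMap.range (D.PhiD2 LinkDiagram.inPlane) ∧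
      LinearMap.range (D.PhiA1 LinkDiagram.inPlane) = LinearMap.range (D.PhiA2 LinkDiagram.inPlane) ∧
      ∀ c : D.Crossing → ℤ,
        ((∃ u, D.PhiD1 LinkDiagram.inPlane u + c = 0) ↔
          ∃ w, D.PhiD2 LinkDiagram.inPlane w + c = 0) ∧
        ((∃ u, D.PhiA1 LinkDiagram.inPlane u + c = 0) ↔
          ∃ w, D.PhiA2 LinkDiagram.inPlane w + c = 0)) ∧
    -- regions on the sphere
    (LinearMap.range (D.PhiD1 LinkDiagram.inSphere) = LinearMap.range (D.PhiD2 LinkDiagram.inSphere) ∧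
      LinearMap.range (D.PhiA1 LinkDiagram.inSphere) = LinearMap.range (D.PhiA2 LinkDiagram.inSphere) ∧
      ∀ c : D.Crossing → ℤ,
        ((∃ u, D.PhiD1 LinkDiagram.inSphere u + c = 0) ↔
          ∃ w, D.PhiD2 LinkDiagram.inSphere w + c = 0) ∧
        ((∃ u, D.PhiA1 LinkDiagram.inSphere u + c = 0) ↔
          ∃ w, D.PhiA2 LinkDiagram.inSphere w + c = 0)) :=
  ⟨LinkDiagram.isInclusion_inPlane.main, LinkDiagram.isInclusion_inSphere.main⟩
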